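/- Let $d\in\{1,2\}$, let $\Omega\subset\mathbb{R}^d$ be open, and let $\mathcal{T}$ be a finite conforming simplicial triangulation of $\overline\Omega$ into non-degenerate simplices (intervals for $d=1$, triangles for $d=2$), i.e. $\overline\Omega=\bigcup_{T\in\mathcal{T}}\overline{T}$ and any two closed simplices intersect in a common face or not at all; elements $T\in\mathcal{T}$ are open simplices. (This covers bounded open intervals for $d=1$ and bounded polygonal Lipschitz domains for $d=2$.) Let $z$ be an interior vertex, that is, a vertex of $\mathcal{T}$ with $z\in\Omega$. Let $\omega_z=\{T\in\mathcal{T}: z\in\overline{T}\}$ be its element patch and let $\Omega_z$ be the interior of $\bigcup_{T\in\omega_z}\overline{T}$. For $k\in\mathbb{N}_0$ let $P^{k}(S)$ denote the polynomials of total degree at most $k$ on $S$, and let $$P^{k}(\omega_z)=\{v\in L^2(\Omega_z): v|_T\in P^{k}(T)\ \text{for all } T\in\omega_z\}.$$ Let $p\in\mathbb{N}_0$ and let $\Pi^p_{\omega_z}\colon L^2(\Omega_z)\to P^p(\omega_z)$ be the $L^2$-orthogonal projection. Then $\Pi^p_{\omega_z}|_{P^{p+1}(\Omega_z)}$ has full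 rank, i.e. $$\ker\bigl(\Pi^p_{\omega_z}|_{P^{p+1}(\Omega_z)}\bigr)=\{0\}.$$ Equivalently, if $q$ is a polynomial of total degree at most $p+1$ such that $\int_T q\,r\,\mathrm{d}x=0$ for all $T\in\omega_z$ and all polynomials $r$ of total degree at most $p$, then $q=0$. -/

import Mathlib

open MeasureTheory

noncomputable section

/-- Value of a polynomial in `d` real variables at a point of `ℝ^d`. -/
def polyEval {d : ℕ} (q : MvPolynomial (Fin d) ℝ) (x : EuclideanSpace ℝ (Fin d)) : ℝ :=
  MvPolynomial.eval (fun i => x i) q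

/-- A (conforming, simplicial) triangulation of the closure of `Ω ⊆ ℝ^d`: a finite simplicial
complex, all of whose faces belong to `d`-dimensional simplices, that covers exactly `closure Ω`. -/
structure Triangulation {d : ℕ} (Ω : Set (EuclideanSpace ℝ (Fin d))) extends
    Geometry.SimplicialComplex ℝ (EuclideanSpace ℝ (Fin d)) where
  finite_faces : faces.Finite
  exists_element : ∀ s ∈ faces, ∃ t ∈ faces, s ⊆ t ∧ t.card = d + 1
  space_eq : toSimplicialComplex.space = closure Ω

/-- The open simplex with vertex set `s`. -/
def openSimplex {d : ℕ} (s : Finset (EuclideanSpace ℝ (Fin d))) : Set (EuclideanSpace ℝ (Fin d)) :=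
  interior (convexHull ℝ (s : Set (EuclideanSpace ℝ (Fin d))))

namespace Triangulation

variable {d : ℕ} {Ω : Set (EuclideanSpace ℝ (Fin d))}

/-- The elements, each one given by its set of `d + 1` vertices; as a subset of `ℝ^d` the element
is `openSimplex s`. -/
def elements (𝒯 : Triangulation Ω) : Set (Finset (EuclideanSpace ℝ (Fin d))) :=
  {s | s ∈ 𝒯.faces ∧ s.card = d + 1}

/-- The vertices that lie in the open set `Ω`, i.e. not on its boundary. -/
def interiorVertices (𝒯 : Triangulation Ω) : Set (EuclideanSpace ℝ (Fin d)) :=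
  {z | z ∈ 𝒯.vertices ∧ z ∈ Ω}

/-- The element patch `ω(S)`: all elements whose closure meets the closure of `S`. -/
def patch (𝒯 : Triangulation Ω) (S : Set (EuclideanSpace ℝ (Fin d))) :
    Set (Finset (EuclideanSpace ℝ (Fin d))) :=
  {s | s ∈ 𝒯.elements ∧ (closure S ∩ closure (openSimplex s)).Nonempty}

/-- The open set `Ω(S)` covered by the element patch of `S`. -/
def patchDomain (𝒯 : Triangulation Ω) (S : Set (EuclideanSpace ℝ (Fin d))) :
    Set (EuclideanSpace ℝ (Fin d)) :=
  interior (⋃ s ∈ 𝒯.patch S, closure (openSimplex s))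

end Triangulation

/-- `P^p(S)` as a subspace of `L²(S)`: the (classes of) polynomials of total degree at most `p`. -/
def polySpace {d : ℕ} (S : Set (EuclideanSpace ℝ (Fin d))) (p : ℕ) :
    Submodule ℝ (Lp ℝ 2 (volume.restrict S)) where
  carrier := {v | ∃ q : MvPolynomial (Fin d) ℝ, q.totalDegree ≤ p ∧
    ∀ᵐ x ∂(volume.restrict S), v x = polyEval q x}
  zero_mem' := ⟨0, by simp, by
    filter_upwards [Lp.coeFn_zero ℝ 2 (volume.restrict S)] with x hx
    simpa [polyEval] using hx⟩
  add_mem' := by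
    rintro v w ⟨q, hq, hv⟩ ⟨r, hr, hw⟩
    refine ⟨q + r, (MvPolynomial.totalDegree_add q r).trans (max_le hq hr), ?_⟩
    filter_upwards [Lp.coeFn_add v w, hv, hw] with x hx h1 h2
    rw [hx, Pi.add_apply, h1, h2]
    simp [polyEval]
  smul_mem' := by
    rintro c v ⟨q, hq, hv⟩
    refine ⟨c • q, (MvPolynomial.totalDegree_smul_le c q).trans hq, ?_⟩
    filter_upwards [Lp.coeFn_smul c v, hv] with x hx h1
    simp [hx, h1, polyEval]

namespace Triangulation

variable {d : ℕ} {Ω : Set (EuclideanSpace ℝ (Fin d))}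

theorem openSimplex_subset_patchDomain (𝒯 : Triangulation Ω)
    {S : Set (EuclideanSpace ℝ (Fin d))} {s : Finset (EuclideanSpace ℝ (Fin d))}
    (hs : s ∈ 𝒯.patch S) : openSimplex s ⊆ 𝒯.patchDomain S :=
  interior_maximal (subset_closure.trans
    (Set.subset_biUnion_of_mem (u := fun s => closure (openSimplex s)) hs)) isOpen_interior

theorem ae_of_patch (𝒯 : Triangulation Ω) (S : Set (EuclideanSpace ℝ (Fin d)))
    {P : EuclideanSpace ℝ (Fin d) → Prop}
    (h : ∀ s ∈ 𝒯.patch S, ∀ᵐ x ∂(volume.restrict (openSimplex s)), P x) :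
    ∀ᵐ x ∂(volume.restrict (𝒯.patchDomain S)), P x := by
  have hfin : (𝒯.patch S).Finite := 𝒯.finite_faces.subset fun s hs => hs.1.1
  have h' : ∀ s ∈ 𝒯.patch S, ∀ᵐ x ∂(volume.restrict (closure (openSimplex s))), P x := by
    intro s hs
    refine ae_mono ?_ (h s hs)
    have hc : Convex ℝ (openSimplex s) := (convex_convexHull ℝ _).interior
    refine (Measure.restrict_congr_set (ae_eq_set.2 ⟨?_, ?_⟩)).le
    · refine measure_mono_null ?_ (hc.addHaar_frontier volume)
      exact Set.sdiff_subset_sdiff_right interior_subset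
    · simp [Set.sdiff_eq_empty.2 subset_closure]
  refine ae_restrict_of_ae_restrict_of_subset interior_subset ?_
  exact (ae_restrict_biUnion_iff _ hfin.countable _).2 h'

/-- `P^p(ω(S))` as a subspace of `L²(Ω(S))`: the functions whose restriction to every element of
the patch is a polynomial of total degree at most `p`. -/
def brokenPolySpace (𝒯 : Triangulation Ω) (S : Set (EuclideanSpace ℝ (Fin d))) (p : ℕ) :
    Submodule ℝ (Lp ℝ 2 (volume.restrict (𝒯.patchDomain S))) where
  carrier := {v | ∀ s ∈ 𝒯.patch S, ∃ q : MvPolynomial (Fin d) ℝ, q.totalDegree ≤ p ∧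
    ∀ᵐ x ∂(volume.restrict (openSimplex s)), v x = polyEval q x}
  zero_mem' := fun s hs => ⟨0, by simp, by
    filter_upwards [ae_restrict_of_ae_restrict_of_subset (𝒯.openSimplex_subset_patchDomain hs)
      (Lp.coeFn_zero ℝ 2 (volume.restrict (𝒯.patchDomain S)))] with x hx
    simpa [polyEval] using hx⟩
  add_mem' := by
    intro v w hv hw s hs
    obtain ⟨q, hq, hv⟩ := hv s hs
    obtain ⟨r, hr, hw⟩ := hw s hs
    refine ⟨q + r, (MvPolynomial.totalDegree_add q r).trans (max_le hq hr), ?_⟩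
    filter_upwards [ae_restrict_of_ae_restrict_of_subset (𝒯.openSimplex_subset_patchDomain hs)
      (Lp.coeFn_add v w), hv, hw] with x hx h1 h2
    rw [hx, Pi.add_apply, h1, h2]
    simp [polyEval]
  smul_mem' := by
    intro c v hv s hs
    obtain ⟨q, hq, hv⟩ := hv s hs
    refine ⟨c • q, (MvPolynomial.totalDegree_smul_le c q).trans hq, ?_⟩
    filter_upwards [ae_restrict_of_ae_restrict_of_subset (𝒯.openSimplex_subset_patchDomain hs)
      (Lp.coeFn_smul c v), hv] with x hx h1
    simp [hx, h1, polyEval]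

/-- Needed for the orthogonal projection onto this subspace to exist. -/
instance finiteDimensional_brokenPolySpace (𝒯 : Triangulation Ω)
    (S : Set (EuclideanSpace ℝ (Fin d))) (p : ℕ) :
    FiniteDimensional ℝ (𝒯.brokenPolySpace S p) := by
  have hfin : (𝒯.patch S).Finite := 𝒯.finite_faces.subset fun s hs => hs.1.1
  have : Finite (𝒯.patch S) := hfin
  choose q hq hv using fun (v : 𝒯.brokenPolySpace S p) (s : 𝒯.patch S) => v.2 s.1 s.2
  -- pairs (local polynomials, function) that agree on every element
  let G : Submodule ℝ ((𝒯.patch S → MvPolynomial.restrictTotalDegree (Fin d) ℝ p) ×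
      Lp ℝ 2 (volume.restrict (𝒯.patchDomain S))) :=
    { carrier := {g | ∀ s : 𝒯.patch S, ∀ᵐ x ∂(volume.restrict (openSimplex s.1)),
        g.2 x = polyEval (g.1 s).1 x}
      zero_mem' := fun s => by
        filter_upwards [ae_restrict_of_ae_restrict_of_subset
          (𝒯.openSimplex_subset_patchDomain s.2)
          (Lp.coeFn_zero ℝ 2 (volume.restrict (𝒯.patchDomain S)))] with x hx
        simpa [polyEval] using hx
      add_mem' := by
        intro g k hg hk s
        filter_upwards [ae_restrict_of_ae_restrict_of_subset
          (𝒯.openSimplex_subset_patchDomain s.2) (Lp.coeFn_add g.2 k.2), hg s, hk s]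
          with x hx h1 h2
        refine hx.trans ?_
        rw [Pi.add_apply, h1, h2]
        simp [polyEval]
      smul_mem' := by
        intro c g hg s
        filter_upwards [ae_restrict_of_ae_restrict_of_subset
          (𝒯.openSimplex_subset_patchDomain s.2) (Lp.coeFn_smul c g.2), hg s] with x hx h1
        simp [hx, h1, polyEval] }
  have hG : FiniteDimensional ℝ G := by
    refine FiniteDimensional.of_injective ((LinearMap.fst ℝ _ _).domRestrict G) ?_
    refine (injective_iff_map_eq_zero _).2 ?_
    rintro ⟨⟨r, v⟩, hg⟩ h0
    have hr : r = 0 := h0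
    subst hr
    have hv0 : v = 0 := by
      apply Lp.ext
      have h1 : ∀ᵐ x ∂(volume.restrict (𝒯.patchDomain S)), v x = 0 := by
        refine 𝒯.ae_of_patch S fun s hs => ?_
        filter_upwards [hg ⟨s, hs⟩] with x hx
        simpa [polyEval] using hx
      filter_upwards [h1, Lp.coeFn_zero ℝ 2 (volume.restrict (𝒯.patchDomain S))] with x h2 h3
      rw [h2, h3]; rfl
    subst hv0
    rfl
  have hle : 𝒯.brokenPolySpace S p ≤ G.map (LinearMap.snd ℝ _ _) := by
    intro v hv'
    refine ⟨(fun s => ⟨q ⟨v, hv'⟩ s, ?_⟩, v), fun s => hv ⟨v, hv'⟩ s, rfl⟩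
    exact (MvPolynomial.mem_restrictTotalDegree _ _ _).2 (hq _ s)
  exact Submodule.finiteDimensional_of_le hle

/-- The `L²`-orthogonal projection of `L²(Ω(S))` onto `P^p(ω(S))`. -/
def l2Projection (𝒯 : Triangulation Ω) (S : Set (EuclideanSpace ℝ (Fin d))) (p : ℕ) :
    Lp ℝ 2 (volume.restrict (𝒯.patchDomain S)) →L[ℝ] 𝒯.brokenPolySpace S p :=
  (𝒯.brokenPolySpace S p).orthogonalProjectionOnto

end Triangulation

end

/-! On the reference simplex the operator `L = ∑ (xᵢ ∂ᵢ² + ∂ᵢ) - E (E + d)`, with `E` the Euler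
operator, is symmetric for the L² product and does not raise degrees. On degree `p + 1` it acts as
`-λ`, `λ = (p + 1) (p + 1 + d)`, up to lower order terms. If `Q` has degree at most `p + 1` and is
orthogonal to degree at most `p`, then `L Q + λ Q` has degree at most `p` and is orthogonal to
itself, so `L Q = -λ Q`. This is a recurrence for the coefficients of `Q`
(`coeff_recurrence_of_orthogonal`).

Pull `q` back from an element at `z` with edge vectors `e`, and let `a_k` be the coefficients of `q`
along `e i`. The recurrence reads `(k+1)² a_{k+1} + ∑_{j≠i} (D_{e j} q)_k = (k(k+d) - λ) a_k`
(`edge_recurrence`). Two triangles that share this edge share all `a_k`; only the transverse vector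
changes, from `e j` to `-β e j + α e i` with `β > 0` (`exists_neighbor`). Comparing the two
relations constrains `α`.

Let `q ≠ 0` and `d = 2`. If `q(z) = 0`, then `q` is nonzero along each edge, and a `k` with `a_k = 0
≠ a_{k+1}` gives `α = -(k+1)(1+β)` across both edges of any one triangle at `z`. If `q(z) ≠ 0`, the
relation at `k = 0` says that the derivative of `q` at `z`, summed over the edges of each element,
is `C = -λ q(z)`. As the edges surround `z`, some edge has a derivative of sign opposite to `C`, and
comparison across the two edges of its triangle gives `α α' = (1+β)(1+β')` with `α' < 0`. In both
cases `α α' > β β'`, so the two neighbours overlap, contradicting conformity (`false_of_neighbors`).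
For `d = 1` there is no transverse term and the same relations conflict on a single interval. -/

/-! ### The Appell operator and its eigenfunctions. -/

/-- The Appell differential operator of the reference simplex, given on monomials. -/
noncomputable def appellOperator (d : ℕ) :
    MvPolynomial (Fin d) ℝ →ₗ[ℝ] MvPolynomial (Fin d) ℝ :=
  (MvPolynomial.basisMonomials (Fin d) ℝ).constr ℝ fun α =>
    -- The truncated subtraction is harmless: where it truncates, the factor `(α i)²` is zero.
    (∑ i, MvPolynomial.monomial (α - Finsupp.single i 1) ((α i : ℝ) ^ 2)) -
      MvPolynomial.monomial α ((α.degree : ℝ) * (α.degree + d))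

theorem appellOperator_monomial {d : ℕ} (α : Fin d →₀ ℕ) :
    appellOperator d (MvPolynomial.monomial α 1) =
    (∑ i, MvPolynomial.monomial (α - Finsupp.single i 1) ((α i : ℝ) ^ 2)) -
      MvPolynomial.monomial α ((α.degree : ℝ) * (α.degree + d)) := by
  have := (MvPolynomial.basisMonomials (Fin d) ℝ).constr_basis ℝ (fun α : Fin d →₀ ℕ =>
    (∑ i, MvPolynomial.monomial (α - Finsupp.single i 1) ((α i : ℝ) ^ 2)) -
      MvPolynomial.monomial α ((α.degree : ℝ) * (α.degree + d))) α
  simpa [appellOperator] using this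

/-- Two linear maps on polynomials agree if they agree on monic monomials. -/
theorem MvPolynomial.linearMap_ext_monomial {σ V : Type*} [AddCommGroup V] [Module ℝ V]
    {f g : MvPolynomial σ ℝ →ₗ[ℝ] V}
    (h : ∀ α, f (MvPolynomial.monomial α 1) = g (MvPolynomial.monomial α 1)) : f = g :=
  (MvPolynomial.basisMonomials σ ℝ).ext fun α => by simpa using h α

theorem coeff_appellOperator {d : ℕ} (Q : MvPolynomial (Fin d) ℝ) (γ : Fin d →₀ ℕ) :
    (appellOperator d Q).coeff γ =
      (∑ i, ((γ i : ℝ) + 1) ^ 2 * Q.coeff (γ + Finsupp.single i 1)) -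
        (γ.degree : ℝ) * (γ.degree + d) * Q.coeff γ := by
  have key : (MvPolynomial.lcoeff ℝ γ).comp (appellOperator d) =
      (∑ i, ((γ i : ℝ) + 1) ^ 2 • MvPolynomial.lcoeff ℝ (γ + Finsupp.single i 1)) -
        ((γ.degree : ℝ) * (γ.degree + d)) • MvPolynomial.lcoeff ℝ γ := by
    refine MvPolynomial.linearMap_ext_monomial fun α => ?_
    classical
    simp only [LinearMap.comp_apply, appellOperator_monomial, LinearMap.sub_apply,
      LinearMap.sum_apply, LinearMap.smul_apply, MvPolynomial.lcoeff_apply,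
      MvPolynomial.coeff_sub, MvPolynomial.coeff_sum, MvPolynomial.coeff_monomial, smul_eq_mul]
    congr 1
    · refine Finset.sum_congr rfl fun i _ => ?_
      by_cases h : α = γ + Finsupp.single i 1
      · subst h
        simp
      · rw [if_neg h, mul_zero]
        split_ifs with h2
        · have : α i = 0 := by
            by_contra h0
            apply h
            rw [← h2]
            exact (tsub_add_cancel_of_le (by simpa [Nat.one_le_iff_ne_zero] using h0)).symm
          simp [this]
        · rfl
    · split_ifs with h
      · subst h; simp
      · simp
  simpa using LinearMap.congr_fun key Q

/-- Only the moment recurrence `hI` is needed. It rewrites every moment that arises as a multiple of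
the moment of `α + β`, so symmetry becomes an identity between factors. -/
theorem appellOperator_symmetric {d : ℕ} (I : MvPolynomial (Fin d) ℝ →ₗ[ℝ] ℝ)
    (hI : ∀ (δ : Fin d →₀ ℕ) (i : Fin d), ((δ i : ℝ) + 1) * I (MvPolynomial.monomial δ 1) =
      ((δ.degree : ℝ) + 1 + d) * I (MvPolynomial.monomial (δ + Finsupp.single i 1) 1))
    (P R : MvPolynomial (Fin d) ℝ) :
    I (appellOperator d P * R) = I (P * appellOperator d R) := by
  have hmono : ∀ (δ : Fin d →₀ ℕ) (c : ℝ), I (MvPolynomial.monomial δ c) =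
      c * I (MvPolynomial.monomial δ 1) := by
    intro δ c
    rw [← smul_eq_mul, ← map_smul, MvPolynomial.smul_monomial, smul_eq_mul, mul_one]
  have hstep : ∀ (α β : Fin d →₀ ℕ) (i : Fin d),
      (α i : ℝ) ^ 2 * I (MvPolynomial.monomial (α - Finsupp.single i 1 + β) 1) -
      (β i : ℝ) ^ 2 * I (MvPolynomial.monomial (α + (β - Finsupp.single i 1)) 1) =
      ((α i : ℝ) - β i) * ((α.degree : ℝ) + β.degree + d) *
        I (MvPolynomial.monomial (α + β) 1) := by
    intro α β i
    by_cases hα : α i = 0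
    · by_cases hβ : β i = 0
      · simp [hα, hβ]
      · have hle : Finsupp.single i 1 ≤ β := by simpa [Nat.one_le_iff_ne_zero] using hβ
        obtain ⟨β', rfl⟩ := exists_add_of_le hle
        have h := hI (α + β') i
        have e1 : α + (Finsupp.single i 1 + β' - Finsupp.single i 1) = α + β' := by
          rw [add_tsub_cancel_left]
        have e2 : α + (Finsupp.single i 1 + β') = α + β' + Finsupp.single i 1 := by abel
        rw [e1, e2]
        simp [hα] at h ⊢
        linear_combination (-(1 + (β' i : ℝ))) * h
    · have hle : Finsupp.single i 1 ≤ α := by simpa [Nat.one_le_iff_ne_zero] using hα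
      obtain ⟨α', rfl⟩ := exists_add_of_le hle
      have e1 : Finsupp.single i 1 + α' - Finsupp.single i 1 = α' := add_tsub_cancel_left _ _
      have e2 : Finsupp.single i 1 + α' + β = α' + β + Finsupp.single i 1 := by abel
      have h := hI (α' + β) i
      rw [e1, e2]
      by_cases hβ : β i = 0
      · simp [hβ] at h ⊢
        linear_combination (1 + (α' i : ℝ)) * h
      · have hle : Finsupp.single i 1 ≤ β := by simpa [Nat.one_le_iff_ne_zero] using hβ
        have e3 : Finsupp.single i 1 + α' + (β - Finsupp.single i 1) = α' + β := by
          rw [add_comm (Finsupp.single i 1) α', add_assoc, add_tsub_cancel_of_le hle]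
        rw [e3]
        simp at h ⊢
        linear_combination (1 + (α' i : ℝ) - β i) * h
  have key : (LinearMap.mul ℝ (MvPolynomial (Fin d) ℝ)).compr₂ I ∘ₗ appellOperator d =
      ((LinearMap.mul ℝ (MvPolynomial (Fin d) ℝ)).compr₂ I).compl₂ (appellOperator d) := by
    refine MvPolynomial.linearMap_ext_monomial fun α => ?_
    refine MvPolynomial.linearMap_ext_monomial fun β => ?_
    simp only [LinearMap.comp_apply, LinearMap.compr₂_apply, LinearMap.mul_apply',
      LinearMap.compl₂_apply]
    rw [appellOperator_monomial, appellOperator_monomial, sub_mul, mul_sub, Finset.sum_mul,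
      Finset.mul_sum]
    simp only [map_sub, map_sum, MvPolynomial.monomial_mul, mul_one, one_mul]
    -- The factor on the right is the difference of `|α| (|α| + d)` and `|β| (|β| + d)`, which is
    -- what the Euler parts contribute.
    have h : ∑ i, ((α i : ℝ) ^ 2 * I (MvPolynomial.monomial (α - Finsupp.single i 1 + β) 1) -
        (β i : ℝ) ^ 2 * I (MvPolynomial.monomial (α + (β - Finsupp.single i 1)) 1)) =
        ((α.degree : ℝ) - β.degree) * ((α.degree : ℝ) + β.degree + d) *
          I (MvPolynomial.monomial (α + β) 1) := by
      simp_rw [hstep]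
      rw [← Finset.sum_mul, ← Finset.sum_mul, Finset.sum_sub_distrib]
      simp [Finsupp.degree_eq_sum]
    rw [Finset.sum_sub_distrib] at h
    have e1 : ∀ i, I (MvPolynomial.monomial (α - Finsupp.single i 1 + β) ((α i : ℝ) ^ 2)) = _ :=
      fun i => hmono _ _
    have e2 : ∀ i, I (MvPolynomial.monomial (α + (β - Finsupp.single i 1)) ((β i : ℝ) ^ 2)) = _ :=
      fun i => hmono _ _
    rw [hmono _ ((α.degree : ℝ) * _), hmono _ ((β.degree : ℝ) * _)]
    simp_rw [e1, e2]
    linear_combination h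
  exact LinearMap.congr_fun₂ key P R

/-- Polynomials of degree at most `p + 1` orthogonal to all polynomials of degree at most `p` are
eigenfunctions of the Appell operator; in terms of coefficients this is a recurrence. -/
theorem coeff_recurrence_of_orthogonal {d : ℕ} (I : MvPolynomial (Fin d) ℝ →ₗ[ℝ] ℝ)
    (hI : ∀ (δ : Fin d →₀ ℕ) (i : Fin d), ((δ i : ℝ) + 1) * I (MvPolynomial.monomial δ 1) =
      ((δ.degree : ℝ) + 1 + d) * I (MvPolynomial.monomial (δ + Finsupp.single i 1) 1))
    (hpos : ∀ S, I (S * S) = 0 → S = 0) {p : ℕ} {Q : MvPolynomial (Fin d) ℝ}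
    (hQ : Q.totalDegree ≤ p + 1) (horth : ∀ R, R.totalDegree ≤ p → I (Q * R) = 0)
    (γ : Fin d →₀ ℕ) :
    ∑ i, ((γ i : ℝ) + 1) ^ 2 * Q.coeff (γ + Finsupp.single i 1) =
      ((γ.degree : ℝ) * (γ.degree + d) - ((p : ℝ) + 1) * (p + 1 + d)) * Q.coeff γ := by
  have hcoeff : ∀ (P : MvPolynomial (Fin d) ℝ) (k : ℕ), P.totalDegree ≤ k →
      ∀ δ : Fin d →₀ ℕ, k < δ.degree → P.coeff δ = 0 := by
    intro P k hP δ hδ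
    refine MvPolynomial.coeff_eq_zero_of_totalDegree_lt (hP.trans_lt ?_)
    exact hδ
  have hdeg : ∀ (P : MvPolynomial (Fin d) ℝ), (∀ δ : Fin d →₀ ℕ, p < δ.degree → P.coeff δ = 0) →
      P.totalDegree ≤ p := by
    intro P hP
    refine Finset.sup_le fun δ hδ => ?_
    by_contra hlt
    exact (MvPolynomial.mem_support_iff.1 hδ) (hP δ (not_le.1 hlt))
  -- The scalar is chosen to cancel the homogeneous part of degree `p + 1`.
  set S := appellOperator d Q + (((p : ℝ) + 1) * (p + 1 + d)) • Q with hS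
  have hSc : ∀ δ, S.coeff δ = (∑ i, ((δ i : ℝ) + 1) ^ 2 * Q.coeff (δ + Finsupp.single i 1)) -
        (δ.degree : ℝ) * (δ.degree + d) * Q.coeff δ +
        ((p : ℝ) + 1) * (p + 1 + d) * Q.coeff δ := by
    intro δ
    simp [hS, coeff_appellOperator]
  have hSdeg : S.totalDegree ≤ p := by
    refine hdeg _ fun δ hδ => ?_
    rw [hSc, Finset.sum_eq_zero fun i _ => by
      rw [hcoeff Q _ hQ _ (by simp; omega), mul_zero]]
    rcases (Nat.succ_le_of_lt hδ).eq_or_lt with h | h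
    · rw [← h]; push_cast; ring
    · rw [hcoeff Q _ hQ _ h]; ring
  have hLS : (appellOperator d S).totalDegree ≤ p := by
    refine hdeg _ fun δ hδ => ?_
    rw [coeff_appellOperator, Finset.sum_eq_zero fun i _ => by
      rw [hcoeff S _ hSdeg _ (by simp; omega), mul_zero], hcoeff S _ hSdeg _ hδ]
    ring
  -- Symmetry moves the operator onto `S`; both `S` and its image have degree at most `p`, so
  -- orthogonality applies to each.
  have hSS : I (S * S) = 0 := by
    have : I (S * S) = I (appellOperator d Q * S) + (((p : ℝ) + 1) * (p + 1 + d)) * I (Q * S) := by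
      conv_lhs => rw [hS, add_mul, ← hS]
      simp
    rw [this, appellOperator_symmetric I hI, horth _ hLS, horth _ hSdeg]
    ring
  have h0 := hSc γ
  rw [hpos S hSS, MvPolynomial.coeff_zero] at h0
  linear_combination -h0

/-! ### Polynomials in the affine coordinates of a simplex and along its edges. -/

/-- The polynomial `t ↦ q (z + t b)`. -/
noncomputable def linePoly {d : ℕ} (q : MvPolynomial (Fin d) ℝ) (z b : EuclideanSpace ℝ (Fin d)) :
    Polynomial ℝ :=
  MvPolynomial.aeval (fun l => Polynomial.C (z l) + Polynomial.C (b l) * Polynomial.X) q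

/-- The polynomial `t ↦ (D_v q) (z + t b)`. -/
noncomputable def lineDerivPoly {d : ℕ} (q : MvPolynomial (Fin d) ℝ)
    (z b : EuclideanSpace ℝ (Fin d)) : EuclideanSpace ℝ (Fin d) →ₗ[ℝ] Polynomial ℝ where
  toFun v := ∑ l, v l • linePoly (MvPolynomial.pderiv l q) z b
  map_add' v w := by simp [add_smul, Finset.sum_add_distrib]
  map_smul' c v := by simp [mul_smul, Finset.smul_sum]

/-- The polynomial `λ ↦ q (z + ∑ j, λ j • e j)`. -/
noncomputable def pullback {d : ℕ} (q : MvPolynomial (Fin d) ℝ) (z : EuclideanSpace ℝ (Fin d))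
    (e : Fin d → EuclideanSpace ℝ (Fin d)) : MvPolynomial (Fin d) ℝ :=
  MvPolynomial.aeval
    (fun l => MvPolynomial.C (z l) + ∑ j, MvPolynomial.C (e j l) * MvPolynomial.X j) q

section

variable {d : ℕ} (q : MvPolynomial (Fin d) ℝ) (z : EuclideanSpace ℝ (Fin d))

theorem eval_pullback (e : Fin d → EuclideanSpace ℝ (Fin d)) (x : Fin d → ℝ) :
    MvPolynomial.eval x (pullback q z e) = polyEval q (z + ∑ j, x j • e j) := by
  induction q using MvPolynomial.induction_on with
  | C a => simp [pullback, polyEval]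
  | add p q hp hq => simp_all [pullback, polyEval]
  | mul_X p i hp =>
    simp only [pullback, polyEval, map_mul] at hp ⊢
    rw [hp]
    simp [mul_comm]

theorem totalDegree_pullback_le (e : Fin d → EuclideanSpace ℝ (Fin d)) :
    (pullback q z e).totalDegree ≤ q.totalDegree := by
  have hlin : ∀ l, (MvPolynomial.C (z l) + ∑ j, MvPolynomial.C (e j l) * MvPolynomial.X j :
      MvPolynomial (Fin d) ℝ).totalDegree ≤ 1 := by
    intro l
    refine (MvPolynomial.totalDegree_add _ _).trans (max_le (by simp) ?_)
    refine MvPolynomial.totalDegree_finsetSum_le fun j _ => ?_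
    refine (MvPolynomial.totalDegree_mul _ _).trans ?_
    simp
  rw [pullback, MvPolynomial.aeval_def, MvPolynomial.eval₂_eq]
  refine MvPolynomial.totalDegree_finsetSum_le fun α hα => ?_
  refine (MvPolynomial.totalDegree_mul _ _).trans ?_
  rw [MvPolynomial.algebraMap_eq, MvPolynomial.totalDegree_C, zero_add]
  refine (MvPolynomial.totalDegree_finsetProd _ _).trans ?_
  refine le_trans (Finset.sum_le_sum fun l _ => ?_) (MvPolynomial.le_totalDegree hα)
  refine (MvPolynomial.totalDegree_pow _ _).trans ?_
  simpa using Nat.mul_le_mul_left (α l) (hlin l)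

/-- The chain rule for a derivation of a polynomial expression. -/
theorem Derivation.apply_aeval {A : Type*} [CommRing A] [Algebra ℝ A] (D : Derivation ℝ A A)
    (f : Fin d → A) :
    D (MvPolynomial.aeval f q) =
      ∑ l, MvPolynomial.aeval f (MvPolynomial.pderiv l q) * D (f l) := by
  induction q using MvPolynomial.induction_on with
  | C a => simp
  | add p q hp hq => simp [hp, hq, add_mul, Finset.sum_add_distrib]
  | mul_X p i hp =>
    have h : ∀ l, MvPolynomial.aeval f (MvPolynomial.pderiv l (p * MvPolynomial.X i)) * D (f l) =
        (if i = l then MvPolynomial.aeval f p * D (f l) else 0) +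
        f i * (MvPolynomial.aeval f (MvPolynomial.pderiv l p) * D (f l)) := by
      intro l
      by_cases h : i = l
      · subst h
        simp
        ring
      · simp [MvPolynomial.pderiv_X_of_ne h, h]
        ring
    simp_rw [h]
    simp [Finset.sum_add_distrib, hp, Finset.mul_sum]

theorem pderiv_pullback (e : Fin d → EuclideanSpace ℝ (Fin d)) (j : Fin d) :
    MvPolynomial.pderiv j (pullback q z e) =
      ∑ l, e j l • pullback (MvPolynomial.pderiv l q) z e := by
  rw [pullback, Derivation.apply_aeval]
  refine Finset.sum_congr rfl fun l _ => ?_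
  simp [MvPolynomial.pderiv_X, Pi.single_apply, pullback, MvPolynomial.smul_eq_C_mul, mul_comm]

theorem derivative_linePoly (b : EuclideanSpace ℝ (Fin d)) :
    Polynomial.derivative (linePoly q z b) = lineDerivPoly q z b b := by
  have h := Derivation.apply_aeval q (Polynomial.derivative' (R := ℝ))
    (fun l => Polynomial.C (z l) + Polynomial.C (b l) * Polynomial.X)
  refine h.trans (Finset.sum_congr rfl fun l _ => ?_)
  rw [mul_comm, Polynomial.smul_eq_C_mul]
  simp [linePoly, Polynomial.derivative']

/-- Restricting to a coordinate axis picks out the coefficients on this axis. -/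
theorem coeff_aeval_single (Q : MvPolynomial (Fin d) ℝ) (i : Fin d) (k : ℕ) :
    (MvPolynomial.aeval (Pi.single i (Polynomial.X : Polynomial ℝ)) Q).coeff k =
      Q.coeff (Finsupp.single i k) := by
  have key : (Polynomial.lcoeff ℝ k).comp (MvPolynomial.aeval
      (Pi.single i (Polynomial.X : Polynomial ℝ)) : MvPolynomial (Fin d) ℝ →ₐ[ℝ] _).toLinearMap =
      MvPolynomial.lcoeff ℝ (Finsupp.single i k) := by
    refine MvPolynomial.linearMap_ext_monomial fun α => ?_
    classical
    simp only [LinearMap.comp_apply, AlgHom.toLinearMap_apply, Polynomial.lcoeff_apply,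
      MvPolynomial.lcoeff_apply, MvPolynomial.coeff_monomial, MvPolynomial.aeval_monomial,
      map_one, one_mul, Finsupp.prod_fintype, pow_zero, implies_true]
    by_cases h : ∃ j ≠ i, α j ≠ 0
    · obtain ⟨j, hj, hα⟩ := h
      rw [Finset.prod_eq_zero (Finset.mem_univ j) (by simp [hj, hα]), if_neg]
      · simp
      · rintro rfl
        simp [hj.symm] at hα
    · push Not at h
      rw [Finset.prod_eq_single i (fun j _ hj => by simp [h j hj]) (by simp)]
      simp only [Pi.single_eq_same, Polynomial.coeff_X_pow]
      have : α = Finsupp.single i (α i) := by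
        ext j
        by_cases hj : j = i
        · subst hj; simp
        · simp [h j hj, Ne.symm hj]
      rw [this, Finsupp.single_eq_same]
      have hiff : k = α i ↔ Finsupp.single i (α i) = Finsupp.single i k := by
        rw [Finsupp.single_injective i |>.eq_iff, eq_comm]
      simp only [hiff]
  exact LinearMap.congr_fun key Q

theorem aeval_single_pullback (e : Fin d → EuclideanSpace ℝ (Fin d)) (i : Fin d) :
    MvPolynomial.aeval (Pi.single i (Polynomial.X : Polynomial ℝ)) (pullback q z e) =
      linePoly q z (e i) := by
  rw [pullback, linePoly, ← AlgHom.comp_apply, MvPolynomial.comp_aeval]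
  congr 2
  funext l
  simp [Pi.single_apply, Polynomial.algebraMap_eq]

/-- The right side involves only `z` and `e i`, so elements sharing an edge share these
coefficients. -/
theorem coeff_single_pullback (e : Fin d → EuclideanSpace ℝ (Fin d)) (i : Fin d) (k : ℕ) :
    (pullback q z e).coeff (Finsupp.single i k) = (linePoly q z (e i)).coeff k := by
  rw [← aeval_single_pullback, coeff_aeval_single]

/-- A coefficient linear in the `j`-th variable is a coefficient of the `j`-th partial derivative on
the axis `i`. This is linear in `e j`, which allows transverse vectors of adjacent elements to be
compared. -/
theorem coeff_single_add_single_pullback (e : Fin d → EuclideanSpace ℝ (Fin d)) {i j : Fin d}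
    (hij : i ≠ j) (k : ℕ) :
    (pullback q z e).coeff (Finsupp.single i k + Finsupp.single j 1) =
      (lineDerivPoly q z (e i) (e j)).coeff k := by
  have h := MvPolynomial.coeff_pderiv (i := j) (pullback q z e) (Finsupp.single i k)
  rw [pderiv_pullback, MvPolynomial.coeff_sum] at h
  simp only [MvPolynomial.coeff_smul, coeff_single_pullback] at h
  simp [hij.symm] at h
  simp [lineDerivPoly, ← h]

theorem coeff_zero_linePoly (b : EuclideanSpace ℝ (Fin d)) :
    (linePoly q z b).coeff 0 = polyEval q z := by
  rw [Polynomial.coeff_zero_eq_eval_zero, linePoly, polyEval]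
  induction q using MvPolynomial.induction_on with
  | C a => simp
  | add p q hp hq => simp_all
  | mul_X p i hp => simp_all

/-- The recurrence of `coeff_recurrence_of_orthogonal` along an edge. -/
theorem edge_recurrence {c : ℝ} {e : Fin d → EuclideanSpace ℝ (Fin d)}
    (h : ∀ γ : Fin d →₀ ℕ,
      ∑ i, ((γ i : ℝ) + 1) ^ 2 * (pullback q z e).coeff (γ + Finsupp.single i 1) =
      ((γ.degree : ℝ) * (γ.degree + d) - c) * (pullback q z e).coeff γ) (i : Fin d) (k : ℕ) :
    ((k : ℝ) + 1) ^ 2 * (linePoly q z (e i)).coeff (k + 1) +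
      ∑ j ∈ Finset.univ.erase i, (lineDerivPoly q z (e i) (e j)).coeff k =
      ((k : ℝ) * (k + d) - c) * (linePoly q z (e i)).coeff k := by
  have := h (Finsupp.single i k)
  rw [← Finset.add_sum_erase _ _ (Finset.mem_univ i), coeff_single_pullback,
    ← Finsupp.single_add, coeff_single_pullback] at this
  simp only [Finsupp.degree_single, Finsupp.single_eq_same] at this
  rw [← this]
  congr 1
  refine Finset.sum_congr rfl fun j hj => ?_
  have hj' : i ≠ j := (Finset.ne_of_mem_erase hj).symm
  rw [coeff_single_add_single_pullback q z e hj']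
  simp [hj'.symm]

theorem coeff_lineDerivPoly_self (b : EuclideanSpace ℝ (Fin d)) (k : ℕ) :
    (lineDerivPoly q z b b).coeff k = ((k : ℝ) + 1) * (linePoly q z b).coeff (k + 1) := by
  rw [← derivative_linePoly, Polynomial.coeff_derivative, mul_comm]

/-- Both sides are the directional derivative of `q` at `z`, whatever line is followed. -/
theorem coeff_zero_lineDerivPoly (a b v : EuclideanSpace ℝ (Fin d)) :
    (lineDerivPoly q z a v).coeff 0 = (lineDerivPoly q z b v).coeff 0 := by
  simp [lineDerivPoly, coeff_zero_linePoly]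

theorem eq_zero_of_pullback_eq_zero (e : Module.Basis (Fin d) ℝ (EuclideanSpace ℝ (Fin d)))
    (h : pullback q z e = 0) : q = 0 := by
  refine MvPolynomial.funext fun x => ?_
  have h1 := eval_pullback q z e (e.repr (WithLp.toLp 2 x - z))
  rw [h, e.sum_repr] at h1
  simpa [polyEval] using h1.symm

end

/-! ### Moments of the reference simplex. -/

/-- The reference simplex. -/
def refSimplex (d : ℕ) : Set (Fin d → ℝ) := {x | (∀ i, 0 ≤ x i) ∧ ∑ i, x i ≤ 1}

theorem isCompact_refSimplex (d : ℕ) : IsCompact (refSimplex d) := by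
  refine (isCompact_Icc (a := (0 : Fin d → ℝ)) (b := 1)).of_isClosed_subset ?_ ?_
  · have : refSimplex d = (⋂ i, {x | 0 ≤ x i}) ∩ {x | ∑ i, x i ≤ 1} := by
      ext x; simp [refSimplex]
    rw [this]
    refine (isClosed_iInter fun i => isClosed_le ?_ ?_).inter (isClosed_le ?_ ?_) <;> fun_prop
  · rintro x ⟨h0, h1⟩
    exact ⟨h0, fun i => (Finset.single_le_sum (fun j _ => h0 j) (Finset.mem_univ i)).trans h1⟩

theorem integrableOn_refSimplex {d : ℕ} (P : MvPolynomial (Fin d) ℝ) :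
    IntegrableOn (fun x => MvPolynomial.eval x P) (refSimplex d) :=
  (MvPolynomial.continuous_eval P).continuousOn.integrableOn_compact (isCompact_refSimplex d)

/-- Integration of polynomials over the reference simplex. -/
noncomputable def refIntegral (d : ℕ) : MvPolynomial (Fin d) ℝ →ₗ[ℝ] ℝ where
  toFun P := ∫ x in refSimplex d, MvPolynomial.eval x P
  map_add' P R := by
    simp only [map_add]
    exact integral_add (integrableOn_refSimplex P) (integrableOn_refSimplex R)
  map_smul' c P := by
    simp [integral_const_mul]

theorem refIntegral_apply {d : ℕ} (P : MvPolynomial (Fin d) ℝ) :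
    refIntegral d P = ∫ x in refSimplex d, MvPolynomial.eval x P := rfl

/-- The continuous square vanishes on a small open cube inside the simplex, and a product of
infinite sets determines a polynomial. -/
theorem eq_zero_of_refIntegral_mul_self {d : ℕ} (S : MvPolynomial (Fin d) ℝ)
    (h : refIntegral d (S * S) = 0) : S = 0 := by
  have hd : (0 : ℝ) < 1 / (d + 1) := by positivity
  have hU : IsOpen (Set.pi Set.univ fun _ : Fin d => Set.Ioo (0 : ℝ) (1 / (d + 1))) :=
    isOpen_set_pi Set.finite_univ fun _ _ => isOpen_Ioo
  have hsub : (Set.pi Set.univ fun _ : Fin d => Set.Ioo (0 : ℝ) (1 / (d + 1))) ⊆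
      refSimplex d := by
    intro x hx
    refine ⟨fun i => (hx i trivial).1.le, ?_⟩
    calc ∑ i, x i ≤ ∑ _i : Fin d, (1 : ℝ) / (d + 1) :=
          Finset.sum_le_sum fun i _ => (hx i trivial).2.le
      _ = d / (d + 1) := by simp [div_eq_mul_inv]
      _ ≤ 1 := by rw [div_le_one (by positivity)]; linarith
  rw [refIntegral_apply, setIntegral_eq_zero_iff_of_nonneg_ae
    (.of_forall fun x => by simpa using mul_self_nonneg _) (integrableOn_refSimplex _)] at h
  have h1 := ae_restrict_of_ae_restrict_of_subset hsub h
  have h2 := Measure.eqOn_open_of_ae_eq h1 hU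
    (MvPolynomial.continuous_eval _).continuousOn continuousOn_const
  refine MvPolynomial.funext_set _ (fun _ => Set.Ioo_infinite hd) fun x hx => ?_
  simpa using h2 hx

theorem setIntegral_refSimplex_one (f : (Fin 1 → ℝ) → ℝ) :
    ∫ x in refSimplex 1, f x = ∫ t in (0 : ℝ)..1, f fun _ => t := by
  have hmp := (volume_preserving_funUnique (Fin 1) ℝ).symm
  have h : ∫ x in refSimplex 1, f x = ∫ t in (MeasurableEquiv.funUnique (Fin 1) ℝ).symm ⁻¹'
      refSimplex 1, f ((MeasurableEquiv.funUnique (Fin 1) ℝ).symm t) := by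
    convert! (hmp.setIntegral_preimage_emb
      (MeasurableEquiv.measurableEmbedding _) f (refSimplex 1)).symm
  rw [h, intervalIntegral.integral_of_le zero_le_one, ← integral_Icc_eq_integral_Ioc]
  have : (MeasurableEquiv.funUnique (Fin 1) ℝ).symm ⁻¹' refSimplex 1 = Set.Icc 0 1 := by
    ext t
    simp [refSimplex, MeasurableEquiv.funUnique]
  rw [this]
  rfl

theorem setIntegral_refSimplex_two (f : (Fin 2 → ℝ) → ℝ) (hf : Continuous f) :
    ∫ x in refSimplex 2, f x = ∫ s in (0 : ℝ)..1, ∫ t in (0 : ℝ)..(1 - s), f ![s, t] := by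
  have hmp := (volume_preserving_finTwoArrow ℝ).symm
  have hint := hf.continuousOn.integrableOn_compact (isCompact_refSimplex 2) (μ := volume)
  have hm := (isCompact_refSimplex 2).measurableSet
  rw [← integral_indicator hm,
    ← hmp.integral_comp (MeasurableEquiv.measurableEmbedding _), Measure.volume_eq_prod,
    integral_prod]
  · rw [intervalIntegral.integral_of_le zero_le_one, ← integral_Icc_eq_integral_Ioc,
      ← integral_indicator measurableSet_Icc]
    congr 1
    funext s
    have h : ∀ t, (refSimplex 2).indicator f ((MeasurableEquiv.finTwoArrow).symm (s, t)) =
        (Set.Icc 0 1).indicator (fun s => (Set.Icc 0 (1 - s)).indicator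
          (fun t => f ![s, t]) t) s := by
      intro t
      have e : (MeasurableEquiv.finTwoArrow (α := ℝ)).symm (s, t) = ![s, t] := rfl
      rw [e]
      by_cases hs : s ∈ Set.Icc (0 : ℝ) 1
      · rw [Set.indicator_of_mem hs]
        by_cases ht : t ∈ Set.Icc 0 (1 - s)
        · rw [Set.indicator_of_mem ht, Set.indicator_of_mem]
          refine ⟨fun i => ?_, ?_⟩
          · fin_cases i
            · exact hs.1
            · exact ht.1
          · simp
            linarith [ht.2]
        · rw [Set.indicator_of_notMem ht, Set.indicator_of_notMem]
          rintro ⟨h0, h1⟩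
          simp at h1
          exact ht ⟨h0 1, by linarith⟩
      · rw [Set.indicator_of_notMem hs, Set.indicator_of_notMem]
        rintro ⟨h0, h1⟩
        simp at h1
        have := h0 1
        simp at this
        exact hs ⟨h0 0, by linarith⟩
    simp_rw [h]
    by_cases hs : s ∈ Set.Icc (0 : ℝ) 1
    · simp only [Set.indicator_of_mem hs]
      rw [integral_indicator measurableSet_Icc, integral_Icc_eq_integral_Ioc,
        intervalIntegral.integral_of_le (by linarith [hs.2])]
    · simp [Set.indicator_of_notMem hs]
  · rw [← Measure.volume_eq_prod]
    exact (hmp.integrable_comp_emb (MeasurableEquiv.measurableEmbedding _)).2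
      ((integrable_indicator_iff hm).2 hint)

/-- Integrate the derivative of `s^(a+1) (1-s)^(c+1)`; the boundary terms vanish. -/
theorem beta_recurrence (a c : ℕ) :
    ((a : ℝ) + 1) * ∫ s in (0 : ℝ)..1, s ^ a * (1 - s) ^ c =
      ((a : ℝ) + c + 2) * ∫ s in (0 : ℝ)..1, s ^ (a + 1) * (1 - s) ^ c := by
  have hderiv : ∀ s ∈ Set.uIcc (0 : ℝ) 1, HasDerivAt (fun s : ℝ => s ^ (a + 1) * (1 - s) ^ (c + 1))
      (((a : ℝ) + 1) * (s ^ a * (1 - s) ^ c) -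
        ((a : ℝ) + c + 2) * (s ^ (a + 1) * (1 - s) ^ c)) s := by
    intro s _
    have h1 := hasDerivAt_pow (a + 1) s
    have h2 := ((hasDerivAt_id s).const_sub 1).pow (c + 1)
    convert! h1.mul h2 using 1
    simp
    ring
  have h := intervalIntegral.integral_eq_sub_of_hasDerivAt hderiv
    (Continuous.intervalIntegrable (by fun_prop) _ _)
  rw [intervalIntegral.integral_sub (Continuous.intervalIntegrable (by fun_prop) _ _)
    (Continuous.intervalIntegrable (by fun_prop) _ _), intervalIntegral.integral_const_mul,
    intervalIntegral.integral_const_mul] at h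
  simp at h
  linarith

theorem beta_recurrence_right (a c : ℕ) :
    ((c : ℝ) + 1) * ∫ s in (0 : ℝ)..1, s ^ a * (1 - s) ^ c =
      ((a : ℝ) + c + 2) * ∫ s in (0 : ℝ)..1, s ^ a * (1 - s) ^ (c + 1) := by
  have h := beta_recurrence a c
  have h2 : ∫ s in (0 : ℝ)..1, s ^ a * (1 - s) ^ (c + 1) =
      (∫ s in (0 : ℝ)..1, s ^ a * (1 - s) ^ c) - ∫ s in (0 : ℝ)..1, s ^ (a + 1) * (1 - s) ^ c := by
    rw [← intervalIntegral.integral_sub (Continuous.intervalIntegrable (by fun_prop) _ _)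
      (Continuous.intervalIntegrable (by fun_prop) _ _)]
    congr 1
    funext s
    ring
  rw [h2]
  linarith

theorem refIntegral_monomial_one (δ : Fin 1 →₀ ℕ) :
    refIntegral 1 (MvPolynomial.monomial δ 1) = 1 / ((δ 0 : ℝ) + 1) := by
  rw [refIntegral_apply, setIntegral_refSimplex_one]
  simp [MvPolynomial.eval_monomial, Finsupp.prod_fintype]

theorem refIntegral_monomial_two (δ : Fin 2 →₀ ℕ) :
    refIntegral 2 (MvPolynomial.monomial δ 1) =
      1 / ((δ 1 : ℝ) + 1) * ∫ s in (0 : ℝ)..1, s ^ (δ 0) * (1 - s) ^ (δ 1 + 1) := by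
  rw [refIntegral_apply, setIntegral_refSimplex_two _ (MvPolynomial.continuous_eval _),
    ← intervalIntegral.integral_const_mul]
  congr 1
  funext s
  simp [MvPolynomial.eval_monomial, Finsupp.prod_fintype]
  ring

/-- The moments are Dirichlet integrals. For `d = 2` the inner integration leaves a Beta integral
with exponents `δ 0` and `δ 1 + 1`, and the two coordinates use the two Beta recurrences. -/
theorem refIntegral_recurrence {d : ℕ} (hd : d = 1 ∨ d = 2) (δ : Fin d →₀ ℕ) (i : Fin d) :
    ((δ i : ℝ) + 1) * refIntegral d (MvPolynomial.monomial δ 1) =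
      ((δ.degree : ℝ) + 1 + d) *
        refIntegral d (MvPolynomial.monomial (δ + Finsupp.single i 1) 1) := by
  rcases hd with rfl | rfl
  · have hi : i = 0 := Subsingleton.elim _ _
    subst hi
    rw [refIntegral_monomial_one, refIntegral_monomial_one]
    simp [Finsupp.degree_eq_sum]
    have h1 : (δ 0 : ℝ) + 1 ≠ 0 := by positivity
    have h2 : (δ 0 : ℝ) + 1 + 1 ≠ 0 := by positivity
    field_simp
  · rw [refIntegral_monomial_two, refIntegral_monomial_two]
    fin_cases i
    · have h := beta_recurrence (δ 0) (δ 1 + 1)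
      simp [Finsupp.degree_eq_sum] at h ⊢
      have h1 : (δ 1 : ℝ) + 1 ≠ 0 := by positivity
      field_simp
      linear_combination h
    · have h := beta_recurrence_right (δ 0) (δ 1 + 1)
      simp [Finsupp.degree_eq_sum] at h ⊢
      have h1 : (δ 1 : ℝ) + 1 ≠ 0 := by positivity
      have h2 : (δ 1 : ℝ) + 1 + 1 ≠ 0 := by positivity
      field_simp
      linear_combination h

/-! ### Simplices, vertices and elements of the triangulation. -/

section

variable {d : ℕ}

/-- The vertices of the simplex at `z` with edge vectors `e`. -/
def simplexVertices (z : EuclideanSpace ℝ (Fin d)) (e : Fin d → EuclideanSpace ℝ (Fin d)) :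
    Set (EuclideanSpace ℝ (Fin d)) :=
  insert z (Set.range fun i => z + e i)

theorem convexHull_simplexVertices (z : EuclideanSpace ℝ (Fin d))
    (e : Fin d → EuclideanSpace ℝ (Fin d)) :
    convexHull ℝ (simplexVertices z e) = (fun c => z + ∑ j, c j • e j) '' refSimplex d := by
  apply Set.Subset.antisymm
  · refine convexHull_min ?_ ?_
    · rintro x (rfl | ⟨i, rfl⟩)
      · exact ⟨0, ⟨fun _ => le_rfl, by simp⟩, by simp⟩
      · refine ⟨Pi.single i 1, ⟨fun j => ?_, by simp⟩, by simp [Pi.single_apply]⟩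
        by_cases h : j = i
        · subst h; simp
        · simp [h]
    · rintro _ ⟨c, ⟨hc0, hc1⟩, rfl⟩ _ ⟨c', ⟨hc0', hc1'⟩, rfl⟩ s t hs ht hst
      refine ⟨s • c + t • c', ⟨fun i => ?_, ?_⟩, ?_⟩
      · have := hc0 i
        have := hc0' i
        simp only [Pi.add_apply, Pi.smul_apply, smul_eq_mul]
        positivity
      · simp only [Pi.add_apply, Pi.smul_apply, smul_eq_mul, Finset.sum_add_distrib,
          ← Finset.mul_sum]
        calc s * ∑ i, c i + t * ∑ i, c' i ≤ s * 1 + t * 1 := by gcongr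
          _ = 1 := by linarith
      · have hz : z = s • z + t • z := by rw [← add_smul, hst, one_smul]
        simp only [Pi.add_apply, Pi.smul_apply, smul_eq_mul, add_smul, mul_smul,
          Finset.sum_add_distrib, ← Finset.smul_sum, smul_add]
        conv_lhs => rw [hz]
        abel
  · rintro _ ⟨c, ⟨hc0, hc1⟩, rfl⟩
    have h := (convex_convexHull ℝ (simplexVertices z e)).sum_mem (t := Finset.univ)
      (w := fun o : Option (Fin d) => o.elim (1 - ∑ i, c i) c)
      (z := fun o : Option (Fin d) => o.elim z fun i => z + e i) ?_ ?_ ?_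
    · convert! h using 1
      simp only [Fintype.sum_option, Option.elim, smul_add, Finset.sum_add_distrib,
        ← Finset.sum_smul, sub_smul, one_smul]
      abel
    · rintro (_ | i) _
      · simpa using hc1
      · exact hc0 i
    · simp [Fintype.sum_option]
    · rintro (_ | i) _
      · exact subset_convexHull ℝ _ (Set.mem_insert _ _)
      · exact subset_convexHull ℝ _ (Set.mem_insert_of_mem _ ⟨i, rfl⟩)

/-- A point of a simplex with positive coordinate at a vertex does not lie in the hull of a set
of vertices that misses this vertex. -/
theorem mem_of_mem_convexHull_inter {z : EuclideanSpace ℝ (Fin d)}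
    (e : Module.Basis (Fin d) ℝ (EuclideanSpace ℝ (Fin d))) {t : Set (EuclideanSpace ℝ (Fin d))}
    {c : Fin d → ℝ} {i : Fin d} (hc : c i ≠ 0)
    (h : z + ∑ j, c j • e j ∈ convexHull ℝ (simplexVertices z e ∩ t)) : z + e i ∈ t := by
  by_contra hi
  have hconv : Convex ℝ {y | e.coord i y = e.coord i z} :=
    convex_hyperplane (e.coord i).isLinear _
  have hsub : simplexVertices z e ∩ t ⊆ {y | e.coord i y = e.coord i z} := by
    rintro y ⟨rfl | ⟨j, rfl⟩, hy⟩
    · rfl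
    · have hj : j ≠ i := by rintro rfl; exact hi hy
      simp [hj.symm]
  have h2 := convexHull_min hsub hconv h
  simp only [Set.mem_ofPred_eq, map_add, map_sum, map_smul, e.coord_apply, e.repr_self] at h2
  simp [Finsupp.single_apply] at h2
  exact hc h2

/-- Integrals over a simplex in terms of integrals over the reference simplex. -/
theorem exists_setIntegral_eq_refSimplex (z : EuclideanSpace ℝ (Fin d))
    (e : Module.Basis (Fin d) ℝ (EuclideanSpace ℝ (Fin d))) :
    ∃ C : ℝ, ∀ f : EuclideanSpace ℝ (Fin d) → ℝ,
      ∫ c in refSimplex d, f (z + ∑ j, c j • e j) =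
        C * ∫ x in interior (convexHull ℝ (simplexVertices z e)), f x := by
  let ψ : (Fin d → ℝ) ≃L[ℝ] EuclideanSpace ℝ (Fin d) := e.equivFunL.symm
  have hψ : ∀ c, ψ c = ∑ j, c j • e j := fun c => e.equivFun_symm_apply c
  -- Uniqueness of Haar measure supplies the constant without a determinant.
  have hH : (Measure.map ψ volume).IsAddHaarMeasure := inferInstance
  have hmap := Measure.isAddLeftInvariant_eq_smul (Measure.map ψ volume)
    (volume : Measure (EuclideanSpace ℝ (Fin d)))
  set κ := Measure.addHaarScalarFactor (Measure.map ψ volume)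
    (volume : Measure (EuclideanSpace ℝ (Fin d)))
  refine ⟨κ, fun f => ?_⟩
  have hcl : IsClosed (convexHull ℝ (simplexVertices z e)) := by
    refine (Set.Finite.isCompact_convexHull (𝕜 := ℝ) ?_).isClosed
    exact (Set.finite_range _).insert _
  have hfr : (interior (convexHull ℝ (simplexVertices z e)) : Set _) =ᵐ[volume]
      convexHull ℝ (simplexVertices z e) :=
    interior_ae_eq_of_null_frontier ((convex_convexHull ℝ _).addHaar_frontier volume)
  rw [setIntegral_congr_set hfr]
  have hpre : convexHull ℝ (simplexVertices z e) =
      (fun x => z + x) '' (ψ '' refSimplex d) := by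
    rw [convexHull_simplexVertices, Set.image_image]
    simp [hψ]
  have h1 : ∫ x in convexHull ℝ (simplexVertices z e), f x =
      ∫ y in ψ '' refSimplex d, f (z + y) := by
    rw [hpre]
    exact (measurePreserving_add_left volume z).setIntegral_image_emb
      (measurableEmbedding_addLeft z) f _
  have h2 : ∫ y in ψ '' refSimplex d, f (z + y) ∂(Measure.map ψ volume) =
      ∫ c in refSimplex d, f (z + ψ c) := by
    have hemb : MeasurableEmbedding ψ := ψ.toHomeomorph.measurableEmbedding
    rw [hemb.setIntegral_map, Set.preimage_image_eq _ ψ.injective]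
  rw [h1, ← smul_eq_mul]
  simp_rw [← hψ]
  rw [← h2, hmap, Measure.restrict_smul]
  exact integral_smul_nnreal_measure _ _

namespace Triangulation

variable {Ω : Set (EuclideanSpace ℝ (Fin d))} (𝒯 : Triangulation Ω)

theorem exists_basis {s : Finset (EuclideanSpace ℝ (Fin d))} (hs : s ∈ 𝒯.elements)
    {z : EuclideanSpace ℝ (Fin d)} (hz : z ∈ s) :
    ∃ e : Module.Basis (Fin d) ℝ (EuclideanSpace ℝ (Fin d)),
      (s : Set (EuclideanSpace ℝ (Fin d))) = simplexVertices z e := by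
  classical
  have hcard : (s.erase z).card = d := by
    rw [Finset.card_erase_of_mem hz, hs.2]; rfl
  let φ : Fin d ≃ s.erase z := (s.erase z).equivFinOfCardEq hcard |>.symm
  have hind := 𝒯.indep hs.1
  rw [affineIndependent_iff_linearIndependent_vsub ℝ _ ⟨z, hz⟩] at hind
  have hφ : ∀ i, (φ i : EuclideanSpace ℝ (Fin d)) ≠ z := fun i => Finset.ne_of_mem_erase (φ i).2
  let g : Fin d → {x : s // x ≠ ⟨z, hz⟩} := fun i =>
    ⟨⟨φ i, Finset.mem_of_mem_erase (φ i).2⟩, fun h => hφ i (congrArg Subtype.val h)⟩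
  have hg : Function.Injective g := by
    intro i j hij
    apply φ.injective
    apply Subtype.ext
    exact congrArg (fun x => ((x : s) : EuclideanSpace ℝ (Fin d))) (congrArg Subtype.val hij)
  have hli := hind.comp g hg
  have hfr : Fintype.card (Fin d) = Module.finrank ℝ (EuclideanSpace ℝ (Fin d)) := by simp
  refine ⟨Module.Basis.mk hli (hli.span_eq_top_of_card_eq_finrank' hfr).ge, ?_⟩
  rw [Module.Basis.coe_mk]
  ext x
  constructor
  · intro hx
    by_cases h : x = z
    · exact Or.inl h
    · refine Or.inr ⟨φ.symm ⟨x, Finset.mem_erase.2 ⟨h, hx⟩⟩, ?_⟩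
      simp [g]
  · rintro (rfl | ⟨i, rfl⟩)
    · exact hz
    · simpa [g] using Finset.mem_of_mem_erase (φ i).2

theorem closure_openSimplex {s : Finset (EuclideanSpace ℝ (Fin d))} (hs : s ∈ 𝒯.elements) :
    closure (openSimplex s) = convexHull ℝ (s : Set (EuclideanSpace ℝ (Fin d))) := by
  have hne : (interior (convexHull ℝ (s : Set (EuclideanSpace ℝ (Fin d))))).Nonempty := by
    rw [interior_convexHull_nonempty_iff_affineSpan_eq_top]
    have h := ((𝒯.indep hs.1).affineSpan_eq_top_iff_card_eq_finrank_add_one).2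
      (by simp [hs.2])
    simpa using h
  rw [openSimplex, (convex_convexHull ℝ _).closure_interior_eq_closure_of_nonempty_interior hne]
  exact (s.finite_toSet.isCompact_convexHull (𝕜 := ℝ)).isClosed.closure_eq

theorem mem_patch_singleton_iff {z : EuclideanSpace ℝ (Fin d)} (hz : z ∈ 𝒯.vertices)
    {s : Finset (EuclideanSpace ℝ (Fin d))} : s ∈ 𝒯.patch {z} ↔ s ∈ 𝒯.elements ∧ z ∈ s := by
  constructor
  · rintro ⟨hs, x, hx, hxs⟩
    rw [closure_singleton, Set.mem_singleton_iff] at hx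
    subst hx
    rw [𝒯.closure_openSimplex hs] at hxs
    exact ⟨hs, (Geometry.SimplicialComplex.vertex_mem_convexHull_iff hz hs.1).1 hxs⟩
  · rintro ⟨hs, hzs⟩
    refine ⟨hs, z, by simp, ?_⟩
    rw [𝒯.closure_openSimplex hs]
    exact subset_convexHull ℝ _ hzs

/-- Elements that contain points close to `x` contain `x`. -/
theorem eventually_forall_element (x : EuclideanSpace ℝ (Fin d)) :
    ∀ᶠ y in nhds x, ∀ t ∈ 𝒯.elements,
      y ∈ convexHull ℝ (t : Set (EuclideanSpace ℝ (Fin d))) →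
      x ∈ convexHull ℝ (t : Set (EuclideanSpace ℝ (Fin d))) := by
  have hfin : 𝒯.elements.Finite := 𝒯.finite_faces.subset fun s hs => hs.1
  rw [Filter.eventually_all_finite hfin]
  intro t _
  by_cases hxt : x ∈ convexHull ℝ (t : Set (EuclideanSpace ℝ (Fin d)))
  · exact .of_forall fun _ _ => hxt
  · have hcl := (t.finite_toSet.isCompact_convexHull (𝕜 := ℝ)).isClosed
    filter_upwards [hcl.isOpen_compl.mem_nhds hxt] with y hy hy'
    exact absurd hy' hy

theorem exists_element_of_mem {y : EuclideanSpace ℝ (Fin d)} (hy : y ∈ Ω) :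
    ∃ t ∈ 𝒯.elements, y ∈ convexHull ℝ (t : Set (EuclideanSpace ℝ (Fin d))) := by
  have hys : y ∈ 𝒯.space := by rw [𝒯.space_eq]; exact subset_closure hy
  obtain ⟨s, hs, hsy⟩ := Geometry.SimplicialComplex.mem_space_iff.1 hys
  obtain ⟨t, ht, hst, hcard⟩ := 𝒯.exists_element s hs
  exact ⟨t, ⟨ht, hcard⟩, convexHull_mono (𝕜 := ℝ) (Finset.coe_subset.2 hst) hsy⟩

/-- A vertex carrying a positive coordinate of a common point of two faces is a common vertex. -/
theorem vertex_mem_of_mem_convexHull {s t : Finset (EuclideanSpace ℝ (Fin d))}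
    (hs : s ∈ 𝒯.faces) (ht : t ∈ 𝒯.faces) {z : EuclideanSpace ℝ (Fin d)}
    {e : Module.Basis (Fin d) ℝ (EuclideanSpace ℝ (Fin d))}
    (hse : (s : Set (EuclideanSpace ℝ (Fin d))) = simplexVertices z e) {c : Fin d → ℝ}
    (hc : c ∈ refSimplex d) {i : Fin d} (hi : c i ≠ 0)
    (hct : z + ∑ j, c j • e j ∈ convexHull ℝ (t : Set (EuclideanSpace ℝ (Fin d)))) :
    z + e i ∈ t := by
  have h := 𝒯.inter_subset_convexHull hs ht ⟨by
    rw [hse, convexHull_simplexVertices]; exact ⟨c, hc, rfl⟩, hct⟩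
  rw [hse] at h
  exact mem_of_mem_convexHull_inter e hi h

/-- By conformity a nonempty open set lies in the hull of the common vertices, so there must be `d +
1` of them. -/
theorem eq_of_mem_openSimplex {s t : Finset (EuclideanSpace ℝ (Fin d))} (hs : s ∈ 𝒯.elements)
    (ht : t ∈ 𝒯.elements) {x : EuclideanSpace ℝ (Fin d)} (hxs : x ∈ openSimplex s)
    (hxt : x ∈ openSimplex t) : s = t := by
  classical
  by_contra hne
  have hU : IsOpen (openSimplex s ∩ openSimplex t) := isOpen_interior.inter isOpen_interior
  have hsub : openSimplex s ∩ openSimplex t ⊆ convexHull ℝ ((s ∩ t : Finset _) : Set _) := by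
    rintro y ⟨h1, h2⟩
    rw [Finset.coe_inter]
    exact 𝒯.inter_subset_convexHull hs.1 ht.1 ⟨interior_subset h1, interior_subset h2⟩
  have hint : (interior (convexHull ℝ ((s ∩ t : Finset _) : Set
      (EuclideanSpace ℝ (Fin d))))).Nonempty := ⟨x, interior_maximal hsub hU ⟨hxs, hxt⟩⟩
  rw [interior_convexHull_nonempty_iff_affineSpan_eq_top] at hint
  have hind : AffineIndependent ℝ ((↑) : (s ∩ t : Finset _) → EuclideanSpace ℝ (Fin d)) :=
    (𝒯.indep hs.1).mono (by simp)
  have hcard := (hind.affineSpan_eq_top_iff_card_eq_finrank_add_one).1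
    (by rw [Subtype.range_coe_subtype]; exact hint)
  simp at hcard
  have h1 : s ∩ t = s := Finset.eq_of_subset_of_card_le Finset.inter_subset_left
    (by rw [hs.2, hcard])
  have h2 : s ∩ t = t := Finset.eq_of_subset_of_card_le Finset.inter_subset_right
    (by rw [ht.2, hcard])
  exact hne (h1.symm.trans h2)

end Triangulation

end

/-! ### Neighbouring triangles at an interior vertex. -/

theorem Fin.sum_univ_two_of_ne {M : Type*} [AddCommMonoid M] {i j : Fin 2} (hij : i ≠ j)
    (f : Fin 2 → M) : ∑ k, f k = f i + f j := by
  have : (Finset.univ : Finset (Fin 2)) = {i, j} := by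
    fin_cases i <;> fin_cases j <;> simp_all <;> decide
  rw [this, Finset.sum_pair hij]

theorem simplexVertices_reindex {d : ℕ} (z : EuclideanSpace ℝ (Fin d))
    (e : Module.Basis (Fin d) ℝ (EuclideanSpace ℝ (Fin d))) (σ : Fin d ≃ Fin d) :
    simplexVertices z (e.reindex σ) = simplexVertices z e := by
  unfold simplexVertices
  congr 1
  ext x
  simp only [Set.mem_range, Module.Basis.reindex_apply]
  constructor
  · rintro ⟨i, rfl⟩; exact ⟨_, rfl⟩
  · rintro ⟨i, rfl⟩; exact ⟨σ i, by simp⟩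

namespace Triangulation

variable {Ω : Set (EuclideanSpace ℝ (Fin 2))} (𝒯 : Triangulation Ω)

/-- Across an edge that emanates from an interior vertex there is another element. -/
theorem exists_neighbor (hΩ : IsOpen Ω) {z : EuclideanSpace ℝ (Fin 2)}
    (hz : z ∈ 𝒯.interiorVertices) {s : Finset (EuclideanSpace ℝ (Fin 2))} (hs : s ∈ 𝒯.elements)
    {e : Module.Basis (Fin 2) ℝ (EuclideanSpace ℝ (Fin 2))}
    (hse : (s : Set (EuclideanSpace ℝ (Fin 2))) = simplexVertices z e) {i j : Fin 2}
    (hij : i ≠ j) :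
    ∃ t ∈ 𝒯.elements, ∃ e' : Module.Basis (Fin 2) ℝ (EuclideanSpace ℝ (Fin 2)),
      (t : Set (EuclideanSpace ℝ (Fin 2))) = simplexVertices z e' ∧ e' i = e i ∧
      ∃ α β : ℝ, 0 < β ∧ e' j = -β • e j + α • e i := by
  have hcont : Filter.Tendsto (fun ε : ℝ => z + ε • e i) (nhdsWithin 0 (Set.Ioi 0)) (nhds z) := by
    have : Continuous (fun ε : ℝ => z + ε • e i) := by fun_prop
    simpa using (this.tendsto 0).mono_left nhdsWithin_le_nhds
  -- A point on the edge, so close to `z` that every element containing it contains `z`.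
  obtain ⟨ε, ⟨hε1, hεΩ, hεz⟩, hε0⟩ := (((Filter.eventually_mem_set.2 (Ioo_mem_nhdsGT zero_lt_one)).and
    ((hcont.eventually (hΩ.mem_nhds hz.2)).and
      (hcont.eventually (𝒯.eventually_forall_element z)))).and self_mem_nhdsWithin).exists
  have hcont2 : Filter.Tendsto (fun δ : ℝ => z + ε • e i - (ε * δ) • e j)
      (nhdsWithin 0 (Set.Ioi 0)) (nhds (z + ε • e i)) := by
    have : Continuous (fun δ : ℝ => z + ε • e i - (ε * δ) • e j) := by fun_prop
    simpa using (this.tendsto 0).mono_left nhdsWithin_le_nhds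
  -- Step off the edge, away from `s`, by so little that any element reached still contains the edge
  -- point; conformity then makes the whole edge an edge of it.
  obtain ⟨δ, ⟨hδΩ, hδz⟩, hδ0⟩ := (((hcont2.eventually (hΩ.mem_nhds hεΩ)).and
      (hcont2.eventually (𝒯.eventually_forall_element _))).and self_mem_nhdsWithin).exists
  replace hε0 : 0 < ε := hε0
  replace hδ0 : 0 < δ := hδ0
  obtain ⟨t, ht, hyt⟩ := 𝒯.exists_element_of_mem hδΩ
  have hxt := hδz t ht hyt
  have hzt : z ∈ t :=
    (Geometry.SimplicialComplex.vertex_mem_convexHull_iff hz.1 ht.1).1 (hεz t ht hxt)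
  have hit : z + e i ∈ t := by
    refine 𝒯.vertex_mem_of_mem_convexHull hs.1 ht.1 hse (c := Pi.single i ε) ⟨fun k => ?_, ?_⟩
      (i := i) (by simpa using hε0.ne') ?_
    · by_cases h : k = i
      · subst h; simpa using hε0.le
      · simp [h]
    · simpa using hε1.2.le
    · simpa [Pi.single_apply] using hxt
  obtain ⟨f, hf⟩ := 𝒯.exists_basis ht hzt
  have hk : ∃ k, f k = e i := by
    have hmem : z + e i ∈ simplexVertices z f := hf ▸ hit
    rcases hmem with h | ⟨k, hk⟩
    · exact absurd (by simpa using h) (e.ne_zero i)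
    · exact ⟨k, by simpa using hk⟩
  obtain ⟨k, hk⟩ := hk
  have hf' : (t : Set (EuclideanSpace ℝ (Fin 2))) =
      simplexVertices z (f.reindex (Equiv.swap k i)) := by rw [simplexVertices_reindex, hf]
  have hfi : f.reindex (Equiv.swap k i) i = e i := by simp [hk]
  refine ⟨t, ht, f.reindex (Equiv.swap k i), hf', hfi, ?_⟩
  rw [hf', convexHull_simplexVertices] at hyt
  obtain ⟨c, ⟨hc0, -⟩, hc⟩ := hyt
  generalize f.reindex (Equiv.swap k i) = e' at *
  simp only [Fin.sum_univ_two_of_ne hij, hfi] at hc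
  have hc' : c j • e' j = (-(ε * δ)) • e j + (ε - c i) • e i := by
    have : c i • e i + c j • e' j = ε • e i - (ε * δ) • e j := by
      rw [← add_right_inj z, hc]; abel
    rw [sub_smul, neg_smul, ← sub_eq_iff_eq_add'.2 this.symm]
    abel
  -- Otherwise the point would lie on the line of the edge, but its `e j`-coordinate relative to `z`
  -- is `-ε δ`.
  have hcj : c j ≠ 0 := by
    intro h0
    have h := congrArg (e.coord j) hc'
    simp [h0, hij, hε0.ne', hδ0.ne'] at h
  have hcj' : 0 < c j := lt_of_le_of_ne (hc0 j) hcj.symm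
  refine ⟨(c j)⁻¹ * (ε - c i), (c j)⁻¹ * (ε * δ), by positivity, ?_⟩
  rw [← inv_smul_smul₀ hcj (e' j), hc', smul_add, smul_smul, smul_smul, mul_neg]

/-- The neighbours of an element across its two edges at `z` overlap if both neighbours are bent
backwards too much. -/
theorem false_of_neighbors {z : EuclideanSpace ℝ (Fin 2)}
    {t t' : Finset (EuclideanSpace ℝ (Fin 2))} (ht : t ∈ 𝒯.elements) (ht' : t' ∈ 𝒯.elements)
    {e f f' : Module.Basis (Fin 2) ℝ (EuclideanSpace ℝ (Fin 2))}
    (hf : (t : Set (EuclideanSpace ℝ (Fin 2))) = simplexVertices z f)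
    (hf' : (t' : Set (EuclideanSpace ℝ (Fin 2))) = simplexVertices z f') {i j : Fin 2}
    (hij : i ≠ j) {α β α' β' : ℝ} (hβ : 0 < β) (hβ' : 0 < β') (hα' : α' < 0)
    (hαβ : β * β' < α * α') (hfi : f i = e i) (hfj : f j = -β • e j + α • e i)
    (hfj' : f' j = e j) (hfi' : f' i = -β' • e i + α' • e j) : False := by
  -- This is `β β' < α α'` rearranged; any `v` strictly between puts the direction `-(e j) - v • e
  -- i` into both cones.
  have hlt : β' / (-α') < -α / β := by
    rw [div_lt_div_iff₀ (by linarith) hβ]; linarith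
  obtain ⟨v, hv1, hv2⟩ := exists_between hlt
  have hv0 : 0 < v := (div_pos hβ' (by linarith)).trans hv1
  rw [div_lt_iff₀ (by linarith)] at hv1
  rw [lt_div_iff₀ hβ] at hv2
  -- the common direction is `-(e j) - v • e i`
  have hA : 0 < -v - α / β := by
    have : v < -α / β := by rwa [lt_div_iff₀ hβ]
    rw [neg_div] at this
    linarith
  have hB : 0 < -1 - α' * v / β' := by
    have : 1 < v * -α' / β' := by rwa [lt_div_iff₀ hβ', one_mul]
    have h2 : v * -α' / β' = -(α' * v / β') := by ring
    linarith
  set A := -v - α / β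
  set B := -1 - α' * v / β'
  -- Dividing by the sum of all four coordinates brings the point into both triangles at once.
  set S := A + 1 / β + B + v / β' with hS
  have hb1 : 0 < 1 / β := by positivity
  have hb2 : 0 < v / β' := by positivity
  have hS0 : 0 < S := by positivity
  -- The common point has the positive coordinate `B / S` at this vertex of `t'`, so conformity
  -- makes it a vertex of `t`.
  have hjt : z + f' j ∈ t := by
    let c' : Fin 2 → ℝ := fun k => if k = i then v / β' / S else B / S
    have hc'i : c' i = v / β' / S := by simp [c']
    have hc'j : c' j = B / S := by simp [c', hij.symm]
    let c : Fin 2 → ℝ := fun k => if k = i then A / S else 1 / β / S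
    have hci : c i = A / S := by simp [c]
    have hcj : c j = 1 / β / S := by simp [c, hij.symm]
    refine 𝒯.vertex_mem_of_mem_convexHull ht'.1 ht.1 hf' (c := c') ⟨fun k => ?_, ?_⟩ (i := j) ?_ ?_
    · simp only [c']; split_ifs <;> positivity
    · rw [Fin.sum_univ_two_of_ne hij, hc'i, hc'j, ← add_div, div_le_one hS0]
      linarith
    · rw [hc'j]; positivity
    · rw [hf, convexHull_simplexVertices]
      refine ⟨c, ⟨fun k => ?_, ?_⟩, ?_⟩
      · simp only [c]; split_ifs <;> positivity
      · rw [Fin.sum_univ_two_of_ne hij, hci, hcj, ← add_div, div_le_one hS0]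
        linarith
      · simp only [Fin.sum_univ_two_of_ne hij, hci, hcj, hc'i, hc'j, hfi, hfj, hfi', hfj']
        congr 1
        have e1 : A / S + 1 / β / S * α = -(v / S) := by simp only [A]; field_simp; ring
        have e2 : 1 / β / S * -β = -(1 / S) := by field_simp
        have e3 : v / β' / S * -β' = -(v / S) := by field_simp
        have e4 : v / β' / S * α' + B / S = -(1 / S) := by simp only [B]; field_simp; ring
        calc (A / S) • e i + (1 / β / S) • (-β • e j + α • e i)
            = (A / S + 1 / β / S * α) • e i + (1 / β / S * -β) • e j := by module
          _ = (v / β' / S * -β') • e i + (v / β' / S * α' + B / S) • e j := by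
              rw [e1, e2, e3, e4]
          _ = _ := by module
  have hmem : z + f' j ∈ simplexVertices z f := hf ▸ hjt
  rw [hfj'] at hmem
  rcases hmem with h | ⟨k, hk⟩
  · exact e.ne_zero j (by simpa using h)
  · replace hk : f k = e j := by simpa using hk
    by_cases hki : k = i
    · rw [hki, hfi] at hk
      exact hij (e.injective hk)
    · have hkj : k = j := by fin_cases i <;> fin_cases j <;> fin_cases k <;> simp_all
      rw [hkj, hfj] at hk
      -- The `e j`-coordinates are `-β < 0` and `1`.
      have h := congrArg (e.coord j) hk
      simp [hij] at h
      linarith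

end Triangulation

/-! ### The eigenfunction relations around an interior vertex. -/

section

variable {d : ℕ}

/-- The recurrence for the coefficients of a polynomial that is orthogonal to lower order
polynomials on the simplex at `z` with edge vectors `e`. -/
theorem coeff_pullback_recurrence (hd : d = 1 ∨ d = 2) {z : EuclideanSpace ℝ (Fin d)}
    (e : Module.Basis (Fin d) ℝ (EuclideanSpace ℝ (Fin d))) {p : ℕ} {q : MvPolynomial (Fin d) ℝ}
    (hq : q.totalDegree ≤ p + 1)
    (horth : ∀ r : MvPolynomial (Fin d) ℝ, r.totalDegree ≤ p →
      ∫ x in interior (convexHull ℝ (simplexVertices z e)), polyEval q x * polyEval r x = 0)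
    (γ : Fin d →₀ ℕ) :
    ∑ i, ((γ i : ℝ) + 1) ^ 2 * (pullback q z e).coeff (γ + Finsupp.single i 1) =
      ((γ.degree : ℝ) * (γ.degree + d) - ((p : ℝ) + 1) * (p + 1 + d)) *
        (pullback q z e).coeff γ := by
  obtain ⟨C, hC⟩ := exists_setIntegral_eq_refSimplex z e
  refine coeff_recurrence_of_orthogonal (refIntegral d) (refIntegral_recurrence hd)
    eq_zero_of_refIntegral_mul_self ((totalDegree_pullback_le q z e).trans hq) (fun R hR => ?_) γ
  -- `R` is the pullback of a polynomial of the same degree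
  let w : EuclideanSpace ℝ (Fin d) := WithLp.toLp 2 fun j => -e.repr z j
  let f : Fin d → EuclideanSpace ℝ (Fin d) := fun l =>
    WithLp.toLp 2 fun j => e.repr (EuclideanSpace.single l 1) j
  have hR' : ∀ c : Fin d → ℝ, polyEval (pullback R w f) (z + ∑ j, c j • e j) =
      MvPolynomial.eval c R := by
    intro c
    rw [polyEval, eval_pullback, polyEval]
    congr 2
    funext j
    have h1 : ∀ x : EuclideanSpace ℝ (Fin d),
        ∑ l, x l * e.repr (EuclideanSpace.single l 1) j = e.repr x j := by
      intro x
      have hx : x = ∑ l, x l • EuclideanSpace.single l (1 : ℝ) := by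
        ext k; simp [Pi.single_apply]
      conv_rhs => rw [hx]
      simp [map_sum, Finsupp.finsetSum_apply]
    have h2 := h1 (z + ∑ j, c j • e j)
    have h3 : e.repr (∑ j, c j • e j) j = c j := by
      simp [map_sum, Finsupp.finsetSum_apply, Finsupp.single_apply]
    rw [map_add, Finsupp.add_apply, h3] at h2
    have h4 : (w + ∑ l, (z + ∑ j, c j • e j) l • f l) j =
        -e.repr z j + ∑ l, (z + ∑ j, c j • e j) l * e.repr (EuclideanSpace.single l 1) j := by
      simp [w, f]
    rw [h4, h2]
    ring
  rw [refIntegral_apply]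
  have h := hC fun x => polyEval q x * polyEval (pullback R w f) x
  -- The value of `C` is irrelevant, because it multiplies a vanishing integral.
  rw [horth _ ((totalDegree_pullback_le R w f).trans hR), mul_zero] at h
  rw [← h]
  simp only [hR', map_mul, eval_pullback]

/-- The recurrence propagates zero coefficients away from an axis: for `d = 2` it determines the
coefficients with exponent `m + 1` in the other variable from those with exponent `m`. -/
theorem linePoly_ne_zero_of_recurrence (hd : d = 1 ∨ d = 2) {z : EuclideanSpace ℝ (Fin d)}
    (e : Module.Basis (Fin d) ℝ (EuclideanSpace ℝ (Fin d))) {q : MvPolynomial (Fin d) ℝ} {c : ℝ}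
    (h : ∀ γ : Fin d →₀ ℕ,
      ∑ i, ((γ i : ℝ) + 1) ^ 2 * (pullback q z e).coeff (γ + Finsupp.single i 1) =
      ((γ.degree : ℝ) * (γ.degree + d) - c) * (pullback q z e).coeff γ)
    (hq : q ≠ 0) (i : Fin d) : linePoly q z (e i) ≠ 0 := by
  intro h0
  refine hq (eq_zero_of_pullback_eq_zero q z e ?_)
  have hbase : ∀ k, (pullback q z e).coeff (Finsupp.single i k) = 0 := by
    intro k
    rw [coeff_single_pullback, h0, Polynomial.coeff_zero]
  rcases hd with rfl | rfl
  · ext γ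
    have : γ = Finsupp.single i (γ i) := by
      refine Finsupp.ext fun j => ?_
      rw [Subsingleton.elim j i, Finsupp.single_eq_same]
    rw [this, hbase, MvPolynomial.coeff_zero]
  · obtain ⟨j, hij⟩ : ∃ j, i ≠ j := by
      obtain ⟨j, hj⟩ := exists_ne i
      exact ⟨j, hj.symm⟩
    have hall : ∀ m k, (pullback q z e).coeff (Finsupp.single i k + Finsupp.single j m) = 0 := by
      intro m
      induction m with
      | zero => intro k; simpa using hbase k
      | succ m ih =>
        intro k
        have hrec := h (Finsupp.single i k + Finsupp.single j m)
        have e1 : Finsupp.single i k + Finsupp.single j m + Finsupp.single i 1 =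
            Finsupp.single i (k + 1) + Finsupp.single j m := by
          rw [Finsupp.single_add]; abel
        have e2 : Finsupp.single i k + Finsupp.single j m + Finsupp.single j 1 =
            Finsupp.single i k + Finsupp.single j (m + 1) := by
          rw [Finsupp.single_add]; abel
        rw [Fin.sum_univ_two_of_ne hij, e1, e2, ih, ih, mul_zero, mul_zero, zero_add,
          mul_eq_zero] at hrec
        refine hrec.resolve_left (pow_ne_zero _ ?_)
        positivity
    ext γ
    have : γ = Finsupp.single i (γ i) + Finsupp.single j (γ j) := by
      ext k
      have hk : k = i ∨ k = j := by omega
      rcases hk with rfl | rfl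
      · simp [hij]
      · simp [hij.symm]
    rw [this, hall, MvPolynomial.coeff_zero]

namespace Triangulation

/-- A linear functional that is nonnegative on the edges at an interior vertex vanishes. -/
theorem linearMap_eq_zero_of_nonneg {Ω : Set (EuclideanSpace ℝ (Fin d))} (hΩ : IsOpen Ω)
    (𝒯 : Triangulation Ω) {z : EuclideanSpace ℝ (Fin d)} (hz : z ∈ 𝒯.interiorVertices)
    (g : EuclideanSpace ℝ (Fin d) →ₗ[ℝ] ℝ)
    (hg : ∀ t ∈ 𝒯.elements, ∀ e : Module.Basis (Fin d) ℝ (EuclideanSpace ℝ (Fin d)),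
      (t : Set (EuclideanSpace ℝ (Fin d))) = simplexVertices z e → ∀ i, 0 ≤ g (e i)) : g = 0 := by
  -- Near `z` every point lies in an element with vertex `z`, so `y - z` is a nonnegative
  -- combination of edge vectors.
  have hnear : ∀ᶠ y in nhds z, 0 ≤ g (y - z) := by
    filter_upwards [𝒯.eventually_forall_element z, hΩ.mem_nhds hz.2] with y hy hyΩ
    obtain ⟨t, ht, hyt⟩ := 𝒯.exists_element_of_mem hyΩ
    have hzt := (Geometry.SimplicialComplex.vertex_mem_convexHull_iff hz.1 ht.1).1 (hy t ht hyt)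
    obtain ⟨e, he⟩ := 𝒯.exists_basis ht hzt
    rw [he, convexHull_simplexVertices] at hyt
    obtain ⟨c, ⟨hc, -⟩, rfl⟩ := hyt
    simp only [add_sub_cancel_left, map_sum, map_smul, smul_eq_mul]
    exact Finset.sum_nonneg fun i _ => mul_nonneg (hc i) (hg t ht e he i)
  have hnonneg : ∀ v, 0 ≤ g v := by
    intro v
    have hcont : Filter.Tendsto (fun ε : ℝ => z + ε • v) (nhdsWithin 0 (Set.Ioi 0)) (nhds z) := by
      have : Continuous (fun ε : ℝ => z + ε • v) := by fun_prop
      simpa using (this.tendsto 0).mono_left nhdsWithin_le_nhds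
    obtain ⟨ε, hε, hε0⟩ := ((hcont.eventually hnear).and self_mem_nhdsWithin).exists
    simp only [add_sub_cancel_left, map_smul, smul_eq_mul] at hε
    exact nonneg_of_mul_nonneg_right hε hε0
  refine LinearMap.ext fun v => ?_
  have h := hnonneg (-v)
  rw [map_neg] at h
  exact le_antisymm (neg_nonneg.1 h) (hnonneg v)

theorem eq_zero_of_orthogonal (hd : d = 1 ∨ d = 2) {Ω : Set (EuclideanSpace ℝ (Fin d))}
    (hΩ : IsOpen Ω) (𝒯 : Triangulation Ω) {z : EuclideanSpace ℝ (Fin d)}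
    (hz : z ∈ 𝒯.interiorVertices) {p : ℕ} {q : MvPolynomial (Fin d) ℝ}
    (hq : q.totalDegree ≤ p + 1)
    (horth : ∀ s ∈ 𝒯.patch {z}, ∀ r : MvPolynomial (Fin d) ℝ, r.totalDegree ≤ p →
      ∫ x in openSimplex s, polyEval q x * polyEval r x = 0) : q = 0 := by
  by_contra hq0
  have hrec : ∀ t ∈ 𝒯.elements, ∀ e : Module.Basis (Fin d) ℝ (EuclideanSpace ℝ (Fin d)),
      (t : Set (EuclideanSpace ℝ (Fin d))) = simplexVertices z e → ∀ γ : Fin d →₀ ℕ,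
      ∑ i, ((γ i : ℝ) + 1) ^ 2 * (pullback q z e).coeff (γ + Finsupp.single i 1) =
      ((γ.degree : ℝ) * (γ.degree + d) - ((p : ℝ) + 1) * (p + 1 + d)) *
        (pullback q z e).coeff γ := by
    intro t ht e he
    refine coeff_pullback_recurrence hd e hq fun r hr => ?_
    have hzt : z ∈ t := by
      have : z ∈ simplexVertices z e := Set.mem_insert _ _
      rw [← he] at this
      exact this
    have := horth t ((𝒯.mem_patch_singleton_iff hz.1).2 ⟨ht, hzt⟩) r hr
    rwa [openSimplex, he] at this
  have hedge := fun t ht e he => edge_recurrence q z (hrec t ht e he)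
  have hne := fun t ht e he => linePoly_ne_zero_of_recurrence hd e (hrec t ht e he) hq0
  by_cases hqz : polyEval q z = 0
  · obtain ⟨s, hs, hzs⟩ := 𝒯.exists_element_of_mem hz.2
    replace hzs := (Geometry.SimplicialComplex.vertex_mem_convexHull_iff hz.1 hs.1).1 hzs
    obtain ⟨e, he⟩ := 𝒯.exists_basis hs hzs
    -- The coefficients start at zero along each edge but do not all vanish, so a zero is somewhere
    -- followed by a nonzero one.
    have horder : ∀ i, ∃ k, (linePoly q z (e i)).coeff k = 0 ∧
        (linePoly q z (e i)).coeff (k + 1) ≠ 0 := by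
      intro i
      by_contra! hcon
      refine hne s hs e he i (Polynomial.ext fun k => ?_)
      rw [Polynomial.coeff_zero]
      induction k with
      | zero => rw [coeff_zero_linePoly, hqz]
      | succ k ih => exact hcon k ih
    rcases hd with rfl | rfl
    · obtain ⟨k, hk0, hk1⟩ := horder 0
      have h := hedge s hs e he 0 k
      rw [hk0, mul_zero, Finset.sum_eq_zero fun j hj =>
        absurd (Subsingleton.elim j 0) (Finset.ne_of_mem_erase hj), add_zero] at h
      have : ((k : ℝ) + 1) ^ 2 ≠ 0 := by positivity
      exact (mul_ne_zero this hk1) h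
    · have hnb : ∀ i j : Fin 2, i ≠ j →
          ∃ t ∈ 𝒯.elements, ∃ f : Module.Basis (Fin 2) ℝ (EuclideanSpace ℝ (Fin 2)),
          (t : Set (EuclideanSpace ℝ (Fin 2))) = simplexVertices z f ∧ f i = e i ∧
          ∃ α β : ℝ, 0 < β ∧ α ≤ -(1 + β) ∧ f j = -β • e j + α • e i := by
        intro i j hij
        obtain ⟨t, ht, f, hf, hfi, α, β, hβ, hfj⟩ := 𝒯.exists_neighbor hΩ hz hs he hij
        refine ⟨t, ht, f, hf, hfi, α, β, hβ, ?_, hfj⟩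
        obtain ⟨k, hk0, hk1⟩ := horder i
        have herase : Finset.univ.erase i = {j} := by
          ext l; simp; omega
        have h1 := hedge s hs e he i k
        have h2 := hedge t ht f hf i k
        rw [herase, Finset.sum_singleton, hk0, mul_zero] at h1
        rw [herase, Finset.sum_singleton, hfi, hfj, hk0, mul_zero, map_add, map_smul, map_smul,
          Polynomial.coeff_add, Polynomial.coeff_smul, Polynomial.coeff_smul,
          coeff_lineDerivPoly_self, smul_eq_mul, smul_eq_mul] at h2
        have hk : (0 : ℝ) < (k : ℝ) + 1 := by positivity
        -- Adding `β` times the relation in `s` to that in `t` cancels the transverse derivative and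
        -- leaves `α = -(k+1)(1+β)`.
        have h3 : ((k : ℝ) + 1) * (linePoly q z (e i)).coeff (k + 1) *
            (α + ((k : ℝ) + 1) * (1 + β)) = 0 := by
          linear_combination h2 + β * h1
        have h4 := (mul_eq_zero.1 h3).resolve_left (mul_ne_zero hk.ne' hk1)
        have hk' : (0 : ℝ) ≤ k := by positivity
        nlinarith [mul_nonneg hk' hβ.le]
      obtain ⟨t, ht, f, hf, hfi, α, β, hβ, hα, hfj⟩ := hnb 0 1 (by decide)
      obtain ⟨t', ht', f', hf', hfj', α', β', hβ', hα', hfi'⟩ := hnb 1 0 (by decide)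
      refine 𝒯.false_of_neighbors ht ht' hf hf' (by decide : (0 : Fin 2) ≠ 1) hβ hβ' (by linarith)
        ?_ hfi hfj hfj' hfi'
      nlinarith [mul_pos hβ hβ', mul_nonneg (sub_nonneg.2 hα) (sub_nonneg.2 hα')]
  · set C : ℝ := -(((p : ℝ) + 1) * (p + 1 + d)) * polyEval q z with hC
    have hC0 : C ≠ 0 := mul_ne_zero (neg_ne_zero.2 (by positivity)) hqz
    let g : EuclideanSpace ℝ (Fin d) →ₗ[ℝ] ℝ := (Polynomial.lcoeff ℝ 0).comp (lineDerivPoly q z 0)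
    have hg : ∀ b v, (lineDerivPoly q z b v).coeff 0 = g v := fun b v =>
      coeff_zero_lineDerivPoly q z b 0 v
    -- The edge relation at `k = 0`; the term with `j = i` is the derivative along the edge itself,
    -- so the sum is over all edge vectors.
    have hsum : ∀ t ∈ 𝒯.elements, ∀ e : Module.Basis (Fin d) ℝ (EuclideanSpace ℝ (Fin d)),
        (t : Set (EuclideanSpace ℝ (Fin d))) = simplexVertices z e → Fin d → ∑ j, g (e j) = C := by
      intro t ht e he i
      have h := hedge t ht e he i 0
      have hs := coeff_lineDerivPoly_self q z (e i) 0
      simp only [hg, Nat.cast_zero, zero_add, one_mul, coeff_zero_linePoly, one_pow] at h hs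
      rw [← hs, Finset.add_sum_erase _ (fun j => g (e j)) (Finset.mem_univ i)] at h
      rw [h, hC]
      ring
    -- If `C * g` were nonnegative on all edges, `g` would vanish, and with it the sum `C`.
    have hex : ∃ t ∈ 𝒯.elements, ∃ e : Module.Basis (Fin d) ℝ (EuclideanSpace ℝ (Fin d)),
        (t : Set (EuclideanSpace ℝ (Fin d))) = simplexVertices z e ∧ ∃ i, C * g (e i) < 0 := by
      by_contra! hcon
      have h0 := 𝒯.linearMap_eq_zero_of_nonneg hΩ hz (C • g) fun t ht e he i => by
        simpa using hcon t ht e he i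
      obtain ⟨s, hs, hzs⟩ := 𝒯.exists_element_of_mem hz.2
      replace hzs := (Geometry.SimplicialComplex.vertex_mem_convexHull_iff hz.1 hs.1).1 hzs
      obtain ⟨e, he⟩ := 𝒯.exists_basis hs hzs
      have hg0 : g = 0 := (smul_eq_zero.1 h0).resolve_left hC0
      have i : Fin d := ⟨0, by omega⟩
      have h1 := hsum s hs e he i
      rw [hg0] at h1
      simp at h1
      exact hC0 h1.symm
    obtain ⟨s, hs, e, he, i, hi⟩ := hex
    have hsum0 := hsum s hs e he i
    rcases hd with rfl | rfl
    · rw [Fintype.sum_subsingleton _ i] at hsum0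
      rw [hsum0] at hi
      nlinarith [mul_self_nonneg C]
    · obtain ⟨j, hj⟩ := exists_ne i
      have hij : i ≠ j := hj.symm
      rw [Fin.sum_univ_two_of_ne hij] at hsum0
      obtain ⟨t, ht, f, hf, hfi, α, β, hβ, hfj⟩ := 𝒯.exists_neighbor hΩ hz hs he hij
      obtain ⟨t', ht', f', hf', hfj', α', β', hβ', hfi'⟩ := 𝒯.exists_neighbor hΩ hz hs he hj
      have h1 := hsum t ht f hf i
      have h2 := hsum t' ht' f' hf' i
      rw [Fin.sum_univ_two_of_ne hij, hfi, hfj, map_add, map_smul, map_smul, smul_eq_mul,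
        smul_eq_mul] at h1
      rw [Fin.sum_univ_two_of_ne hij, hfi', hfj', map_add, map_smul, map_smul, smul_eq_mul,
        smul_eq_mul] at h2
      have hCC : 0 < C * C := mul_self_pos.2 hC0
      have hj0 : 0 < C * g (e j) := by
        have : C * g (e j) = C * C - C * g (e i) := by rw [← hsum0]; ring
        linarith
      have hα : α * (C * g (e i)) = (1 + β) * (C * g (e j)) := by
        linear_combination C * h1 - C * hsum0
      have hα' : α' * (C * g (e j)) = (1 + β') * (C * g (e i)) := by
        linear_combination C * h2 - C * hsum0
      have hα'0 : α' < 0 := by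
        by_contra! hcon
        have : 0 ≤ α' * (C * g (e j)) := mul_nonneg hcon hj0.le
        nlinarith
      -- Multiply the two relations; the factors `C * g (e i)` and `C * g (e j)` are nonzero and
      -- cancel.
      have hprod : α * α' = (1 + β) * (1 + β') := by
        have hne0 : (C * g (e i)) * (C * g (e j)) ≠ 0 := mul_ne_zero hi.ne hj0.ne'
        apply mul_right_cancel₀ hne0
        linear_combination (α' * (C * g (e j))) * hα + ((1 + β) * (C * g (e j))) * hα'
      refine 𝒯.false_of_neighbors ht ht' hf hf' hij hβ hβ' hα'0 ?_ hfi hfj hfj' hfi'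
      rw [hprod]
      nlinarith

end Triangulation

end

/-! ### From the kernel of the projection to elementwise orthogonality. -/

section

variable {d : ℕ}

theorem continuous_polyEval (q : MvPolynomial (Fin d) ℝ) : Continuous (polyEval q) :=
  (MvPolynomial.continuous_eval q).comp (by fun_prop)

theorem memLp_indicator_openSimplex (s : Finset (EuclideanSpace ℝ (Fin d)))
    (r : MvPolynomial (Fin d) ℝ) (U : Set (EuclideanSpace ℝ (Fin d))) :
    MemLp ((openSimplex s).indicator (polyEval r)) 2 (volume.restrict U) := by
  have hm : MeasurableSet (openSimplex s) := isOpen_interior.measurableSet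
  have hK := s.finite_toSet.isCompact_convexHull (𝕜 := ℝ)
  refine MemLp.mono_measure Measure.restrict_le_self ((memLp_indicator_iff_restrict hm).2 ?_)
  obtain ⟨C, hC⟩ := hK.exists_bound_of_continuousOn (continuous_polyEval r).continuousOn
  have : IsFiniteMeasure (volume.restrict (openSimplex s)) :=
    ⟨by
      rw [Measure.restrict_apply_univ]
      exact (measure_mono interior_subset).trans_lt hK.measure_lt_top⟩
  refine MemLp.of_bound (continuous_polyEval r).aestronglyMeasurable C ?_
  filter_upwards [ae_restrict_mem hm] with x hx
  exact hC x (interior_subset hx)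

namespace Triangulation

variable {Ω : Set (EuclideanSpace ℝ (Fin d))} (𝒯 : Triangulation Ω)

/-- Distinct open elements are disjoint, so extension by zero is piecewise polynomial; these are the
test functions that localise orthogonality to one element. -/
theorem toLp_indicator_mem_brokenPolySpace {S : Set (EuclideanSpace ℝ (Fin d))}
    {s : Finset (EuclideanSpace ℝ (Fin d))} (hs : s ∈ 𝒯.patch S) {p : ℕ}
    {r : MvPolynomial (Fin d) ℝ} (hr : r.totalDegree ≤ p) :
    (memLp_indicator_openSimplex s r (𝒯.patchDomain S)).toLp ∈ 𝒯.brokenPolySpace S p := by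
  intro t ht
  have hae := ae_restrict_of_ae_restrict_of_subset (𝒯.openSimplex_subset_patchDomain ht)
    (memLp_indicator_openSimplex s r (𝒯.patchDomain S)).coeFn_toLp
  have hmem := ae_restrict_mem (μ := volume) (s := openSimplex t) isOpen_interior.measurableSet
  by_cases hst : s = t
  · subst hst
    refine ⟨r, hr, ?_⟩
    filter_upwards [hae, hmem] with x hx hxs
    rw [hx, Set.indicator_of_mem hxs]
  · refine ⟨0, by simp, ?_⟩
    filter_upwards [hae, hmem] with x hx hxt
    rw [hx, Set.indicator_of_notMem fun hxs => hst (𝒯.eq_of_mem_openSimplex hs.1 ht.1 hxs hxt)]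
    simp [polyEval]

/-- Polynomials in the kernel of the projection are orthogonal to polynomials on each element. -/
theorem setIntegral_eq_zero_of_l2Projection_eq_zero {S : Set (EuclideanSpace ℝ (Fin d))} {p : ℕ}
    {v : Lp ℝ 2 (volume.restrict (𝒯.patchDomain S))} (hv : 𝒯.l2Projection S p v = 0)
    {q : MvPolynomial (Fin d) ℝ}
    (hq : ∀ᵐ x ∂(volume.restrict (𝒯.patchDomain S)), v x = polyEval q x)
    {s : Finset (EuclideanSpace ℝ (Fin d))} (hs : s ∈ 𝒯.patch S)
    {r : MvPolynomial (Fin d) ℝ} (hr : r.totalDegree ≤ p) :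
    ∫ x in openSimplex s, polyEval q x * polyEval r x = 0 := by
  have hm : MeasurableSet (openSimplex s) := isOpen_interior.measurableSet
  have horth : v ∈ (𝒯.brokenPolySpace S p)ᗮ := by
    rwa [l2Projection, Submodule.orthogonalProjectionOnto_eq_zero_iff] at hv
  have h := (Submodule.mem_orthogonal _ _).1 horth _ (𝒯.toLp_indicator_mem_brokenPolySpace hs hr)
  rw [L2.inner_def] at h
  have hcongr : ∀ᵐ x ∂(volume.restrict (𝒯.patchDomain S)),
      inner ℝ ((memLp_indicator_openSimplex s r (𝒯.patchDomain S)).toLp _ x) (v x) =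
      (openSimplex s).indicator (fun x => polyEval q x * polyEval r x) x := by
    filter_upwards [(memLp_indicator_openSimplex s r (𝒯.patchDomain S)).coeFn_toLp, hq]
      with x h1 h2
    rw [h1, h2]
    by_cases hx : x ∈ openSimplex s
    · simp [hx]
    · simp [hx]
  rw [integral_congr_ae hcongr, integral_indicator hm, Measure.restrict_restrict hm,
    Set.inter_eq_left.2 (𝒯.openSimplex_subset_patchDomain hs)] at h
  exact h

end Triangulation

end

theorem lemma3p2 {d : ℕ} (hd : d = 1 ∨ d = 2) {Ω : Set (EuclideanSpace ℝ (Fin d))}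
    (hΩ : IsOpen Ω) (𝒯 : Triangulation Ω) (z : EuclideanSpace ℝ (Fin d))
    (hz : z ∈ 𝒯.interiorVertices) (p : ℕ) :
    LinearMap.ker ((𝒯.l2Projection {z} p).toLinearMap.domRestrict
        (polySpace (𝒯.patchDomain {z}) (p + 1))) = ⊥ ∧
      ∀ q : MvPolynomial (Fin d) ℝ, q.totalDegree ≤ p + 1 →
        (∀ s ∈ 𝒯.patch {z}, ∀ r : MvPolynomial (Fin d) ℝ, r.totalDegree ≤ p →
          ∫ x in openSimplex s, polyEval q x * polyEval r x = 0) →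
        q = 0 := by
  refine ⟨?_, fun q hq horth => 𝒯.eq_zero_of_orthogonal hd hΩ hz hq horth⟩
  rw [LinearMap.ker_eq_bot']
  rintro ⟨v, q, hq, hv⟩ h0
  have hq0 : q = 0 := 𝒯.eq_zero_of_orthogonal hd hΩ hz hq fun s hs r hr =>
    𝒯.setIntegral_eq_zero_of_l2Projection_eq_zero h0 hv hs hr
  refine Subtype.ext (Lp.ext ?_)
  filter_upwards [hv, Lp.coeFn_zero ℝ 2 (volume.restrict (𝒯.patchDomain {z}))] with x h1 h2
  rw [h1, hq0]
  simpa [polyEval] using h2.symm
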